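/- Let $\tau\in\mathbb H$, $\Lambda=\mathbb Z+\tau\mathbb Z$ and $C=\mathbb C/\Lambda$. Let $\wp$, $\sigma$ be the Weierstrass functions of $\Lambda$ and $\zeta(u)=\frac1u+\sum_{l\in\Lambda\setminus 0}\left(\frac1{u-l}+\frac1l+\frac u{l^2}\right)$, so that $\zeta'=-\wp$; for $\gamma\in\Lambda$ let $\zeta(\gamma)$ denote the quasi-period $\zeta(u+\gamma)-\zeta(u)$, which does not depend on $u\notin\Lambda$. Let $A_0\to C$ be the affine $\mathbb C$-bundle obtained by gluing $(C-\{0\})\times\mathbb C$, with coordinates $(u_0,c)$, and $V\times\mathbb C$, with $V$ a small neighbourhood of $0\in C$ and coordinates $(u_0,c_0)$, by $c_0=c+\frac1{u_0}$. A rank one connection on $C$ is a holomorphic line bundle on $C$ with a holomorphic connection. (1) $A_0$ is a complex surface, and $A_0\to C$ has no holomorphic section (so that $A_0$ is the complement of the section $\sigma_\infty$ in an undecomposable $\mathbb P^1$-bundle). (2) Isomorphism classes of rank one connections on $C$ are in bijection with the points of $A_0$: every point is the parameter of a connection, every connection has exactly one parameter, and two connections are isomorphic if and only if they have the same parameter.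 Here $(u_0,c)$, $u_0\neq0$, is the parameter of the connections given, in some meromorphic trivialization of the line bundle, by $$\frac{dz}z=\left(\frac{\wp'(u)+\wp'(u_0)}{2(\wp(u)-\wp(u_0))}+c\right)du,$$ and $(0,c_0)$ is the parameter of those given in this way by $\frac{dz}z=c_0\,du$. Two connections have isomorphic underlying line bundles if and only if their parameters lie over the same point of $C$. (3) For $u_0\notin\Lambda$ the function $z(u)=\frac{\sigma(u-u_0)}{\sigma(u)}e^{(\zeta(u_0)+c)u}$ solves the equation displayed in (2) and satisfies $z(u+\gamma)=e^{-u_0\zeta(\gamma)+\zeta(u_0)\gamma+c\gamma}z(u)$ for $\gamma\in\Lambda$. (4) There is an analytic isomorphism (a biholomorphic map) $\mathcal M:A_0\to\mathbb C^*\times\mathbb C^*$ given by $$\mathcal M(u_0,c)=\left(e^{-u_0\zeta(1)+\zeta(u_0)+c},\;e^{-u_0\zeta(\tau)+\zeta(u_0)\tau+c\tau}\right)\ (u_0\neq0),\qquad \mathcal M(0,c_0)=(e^{c_0},e^{c_0\tau}),$$ and it is the monodromy map: a connection with parameter $p$ has monodromy $\rho:\pi_1(C)=\Lambda\to\mathbb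 C^*$ if and only if $\mathcal M(p)=(\rho(1),\rho(\tau))$. It carries the tensor product of connections to multiplication: if $E,E'$ have parameters $p,p'$ and $E\otimes E'$ has parameter $q$, then $\mathcal M(q)=\mathcal M(p)\mathcal M(p')$. -/

import Mathlib

open Complex Topology Filter
open scoped Manifold ContDiff PeriodPair

noncomputable section

namespace EllipticRH

/-- The pair of periods `(1, τ)`, whose lattice is `ℤ + τℤ`. -/
def periods (τ : UpperHalfPlane) : PeriodPair where
  ω₁ := 1
  ω₂ := τ
  indep := by
    rw [LinearIndependent.pair_iff]
    intro s t h
    have hi := congrArg Complex.im h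
    have hr := congrArg Complex.re h
    simp at hi hr
    have ht : t = 0 := by
      rcases hi with h | h
      · exact h
      · exact absurd h τ.im_ne_zero
    subst ht
    simpa using hr

/-! ### Weierstrass functions -/

/-- The Weierstrass zeta function `1/z + ∑_{l ≠ 0} (1/(z-l) + 1/l + z/l²)` of a lattice.
As division by zero is zero, the term `l = 0` of the sum below is `1/z`. -/
def zeta (L : PeriodPair) (z : ℂ) : ℂ :=
  ∑' l : L.lattice, (1 / (z - l) + 1 / (l : ℂ) + z / (l : ℂ) ^ 2)

/-- The Weierstrass sigma function `z ∏_{l ≠ 0} (1 - z/l) exp(z/l + z²/(2l²))` of a lattice.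
As division by zero is zero, the factor `l = 0` of the product below is `1`. -/
def sigma (L : PeriodPair) (z : ℂ) : ℂ :=
  z * ∏' l : L.lattice, (1 - z / (l : ℂ)) * exp (z / (l : ℂ) + z ^ 2 / (2 * (l : ℂ) ^ 2))

/-- The quasi-period of `ζ` along a lattice vector `γ` (often written `ζ(γ)`): the increment
`ζ(u + γ) - ζ(u)`, which does not depend on `u`, evaluated at the point `u = ω₁ / 2`. -/
def quasiPeriod (L : PeriodPair) (γ : L.lattice) : ℂ :=
  zeta L (L.ω₁ / 2 + γ) - zeta L (L.ω₁ / 2)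

/-! ### The elliptic curve -/

/-- The elliptic curve `C = ℂ / Λ`. -/
abbrev Curve (L : PeriodPair) : Type := ℂ ⧸ L.lattice.toAddSubgroup

/-- The projection `ℂ → C`. -/
def proj (L : PeriodPair) (u : ℂ) : Curve L := QuotientAddGroup.mk u

lemma proj_surjective (L : PeriodPair) : Function.Surjective (proj L) :=
  QuotientAddGroup.mk_surjective

lemma isLocalHomeomorph_proj (L : PeriodPair) : IsLocalHomeomorph (proj L) := by
  refine IsCoveringMap.isLocalHomeomorph ?_
  refine (AddSubgroup.isAddQuotientCoveringMap_of_comm L.lattice.toAddSubgroup ?_).isCoveringMap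
  exact ⟨inferInstanceAs (DiscreteTopology L.lattice)⟩

/-- The complex structure of `C`: the charts are the local inverses of `ℂ → C`. -/
instance (L : PeriodPair) : ChartedSpace ℂ (Curve L) :=
  (isLocalHomeomorph_proj L).chartedSpace (proj_surjective L)

/-! ### The affine bundle `A₀` -/

/-- A local inverse of `ℂ → C`, defined near `0 ∈ C` and with values near `0 ∈ ℂ`. -/
def lift₀ (L : PeriodPair) : OpenPartialHomeomorph (Curve L) ℂ :=
  ((isLocalHomeomorph_proj L) 0).choose.symm

lemma zero_mem_lift₀_target (L : PeriodPair) : (0 : ℂ) ∈ (lift₀ L).target :=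
  ((isLocalHomeomorph_proj L) 0).choose_spec.1

lemma lift₀_symm (L : PeriodPair) : ⇑(lift₀ L).symm = proj L := by
  rw [lift₀, OpenPartialHomeomorph.symm_symm]
  exact ((isLocalHomeomorph_proj L) 0).choose_spec.2.symm

lemma proj_lift₀ (L : PeriodPair) {b : Curve L} (hb : b ∈ (lift₀ L).source) :
    proj L (lift₀ L b) = b := by
  rw [← lift₀_symm]; exact (lift₀ L).left_inv hb

lemma zero_mem_lift₀_source (L : PeriodPair) : (0 : Curve L) ∈ (lift₀ L).source := by
  have h := (lift₀ L).map_target (zero_mem_lift₀_target L)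
  rw [lift₀_symm] at h
  exact h

lemma lift₀_ne_zero (L : PeriodPair) {b : Curve L} (hb : b ∈ (lift₀ L).source) (h : b ≠ 0) :
    lift₀ L b ≠ 0 := by
  intro h0
  apply h
  rw [← proj_lift₀ L hb, h0]
  rfl

/-- The two open sets over which `A₀` is trivial: `C - {0}` (index `false`) and a neighbourhood
of `0` (index `true`). -/
def chartBase (L : PeriodPair) : Bool → Set (Curve L)
  | false => {0}ᶜ
  | true => (lift₀ L).source

/-- The fibre coordinate of the chart `i` minus the fibre coordinate `c` of the main chart:
`0` for `i = false`, and `1 / u₀` for `i = true` (that is, `c₀ = c + 1 / u₀`). -/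
def chartShift (L : PeriodPair) : Bool → Curve L → ℂ
  | false, _ => 0
  | true, b => (lift₀ L b)⁻¹

open Classical in
/-- The gluing data of `A₀`: the charts `(u₀, c) ∈ (C - {0}) × ℂ` and `(u₀, c₀) ∈ (C, 0) × ℂ`
are glued by `(u₀, c) ↦ (u₀, c₀) = (u₀, c + 1 / u₀)`. -/
def affineBundleCore (L : PeriodPair) : FiberBundleCore Bool (Curve L) ℂ where
  baseSet := chartBase L
  isOpen_baseSet i := by
    cases i
    · have : IsClosed (L.lattice.toAddSubgroup : Set ℂ) := L.isClosed_lattice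
      exact (isClosed_singleton (X := Curve L)).isOpen_compl
    · exact (lift₀ L).open_source
  indexAt b := if b = 0 then true else false
  mem_baseSet_at b := by
    by_cases h : b = 0
    · simpa [h, chartBase] using zero_mem_lift₀_source L
    · simp [h, chartBase]
  coordChange i j b v := v + (chartShift L j b - chartShift L i b)
  coordChange_self i b _ v := by simp
  continuousOn_coordChange i j := by
    have key : ContinuousOn (fun p : Curve L × ℂ => (lift₀ L p.1)⁻¹)
        (((lift₀ L).source ∩ {0}ᶜ) ×ˢ Set.univ) := by
      refine ContinuousOn.inv₀ ?_ fun p hp => lift₀_ne_zero L hp.1.1 hp.1.2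
      exact (lift₀ L).continuousOn.comp continuousOn_fst fun p hp => hp.1.1
    cases i <;> cases j
    · simpa [chartShift] using continuousOn_snd
    · simp only [chartShift, sub_zero]
      refine continuousOn_snd.add (key.mono ?_)
      rintro p ⟨⟨h₁, h₂⟩, _⟩
      exact ⟨⟨h₂, h₁⟩, trivial⟩
    · simp only [chartShift, zero_sub]
      refine continuousOn_snd.add (key.mono ?_).neg
      rintro p ⟨⟨h₁, h₂⟩, _⟩
      exact ⟨⟨h₁, h₂⟩, trivial⟩
    · simpa using continuousOn_snd
  coordChange_comp i j k b _ v := by ring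

/-- The affine bundle `A₀ → C`, a complex surface through its structure of fibre bundle over `C`. -/
abbrev A₀ (L : PeriodPair) : Type := (affineBundleCore L).TotalSpace

/-- The point of `A₀` with main coordinates `(u₀, c)`, for `u₀ ∉ Λ`. -/
def mainPoint (L : PeriodPair) (u₀ c : ℂ) : A₀ L := ⟨proj L u₀, c⟩

/-- The point `(0, c₀)` of `A₀`, over `0 ∈ C`. -/
def zeroPoint (L : PeriodPair) (c₀ : ℂ) : A₀ L := ⟨0, c₀⟩

lemma proj_eq_zero_iff (L : PeriodPair) (u : ℂ) : proj L u = 0 ↔ u ∈ L.lattice :=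
  QuotientAddGroup.eq_zero_iff u

/-- `mainPoint` is expressed in the main chart. -/
lemma localTriv_mainPoint (L : PeriodPair) {u₀ : ℂ} (h : u₀ ∉ L.lattice) (c : ℂ) :
    (affineBundleCore L).localTriv false (mainPoint L u₀ c) = (proj L u₀, c) := by
  have h' : proj L u₀ ≠ 0 := fun e => h ((proj_eq_zero_iff L u₀).1 e)
  rw [FiberBundleCore.localTriv_apply]
  simp [affineBundleCore, mainPoint, h', chartShift]

/-- The coordinate of `mainPoint` in the chart at `0` is `c₀ = c + 1 / u₀`. -/
lemma localTriv_mainPoint' (L : PeriodPair) {u₀ : ℂ} (h : u₀ ∉ L.lattice)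
    (hu : u₀ ∈ (lift₀ L).target) (c : ℂ) :
    (affineBundleCore L).localTriv true (mainPoint L u₀ c) = (proj L u₀, c + 1 / u₀) := by
  have h' : proj L u₀ ≠ 0 := fun e => h ((proj_eq_zero_iff L u₀).1 e)
  have h'' : lift₀ L (proj L u₀) = u₀ := by
    rw [← lift₀_symm]; exact (lift₀ L).right_inv hu
  rw [FiberBundleCore.localTriv_apply]
  simp [affineBundleCore, mainPoint, h', h'', chartShift]

/-- `zeroPoint` is expressed in the chart at `0`. -/
lemma localTriv_zeroPoint (L : PeriodPair) (c₀ : ℂ) :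
    (affineBundleCore L).localTriv true (zeroPoint L c₀) = (0, c₀) := by
  rw [FiberBundleCore.localTriv_apply]
  simp [affineBundleCore, zeroPoint]

/-! ### Line bundles and connections on `C` -/

/-- A function on an open subset `U` of `C` is holomorphic if its pullback to `ℂ` is. -/
def HolomorphicOn (L : PeriodPair) (f : Curve L → ℂ) (U : Set (Curve L)) : Prop :=
  DifferentiableOn ℂ (fun u => f (proj L u)) (proj L ⁻¹' U)

/-- A holomorphic line bundle on `C`, given by an open cover `U i` and transition functions `g i j`:
a section over `V` is a family of functions `s i` on `V ∩ U i` with `s i = g i j * s j`. -/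
structure LineBundle (L : PeriodPair) where
  ι : Type
  U : ι → Set (Curve L)
  isOpen_U : ∀ i, IsOpen (U i)
  cover : ∀ x, ∃ i, x ∈ U i
  g : ι → ι → Curve L → ℂ
  holomorphic_g : ∀ i j, HolomorphicOn L (g i j) (U i ∩ U j)
  g_ne_zero : ∀ i j, ∀ x ∈ U i ∩ U j, g i j x ≠ 0
  cocycle : ∀ i j k, ∀ x ∈ U i ∩ U j ∩ U k, g i j x * g j k x = g i k x

/-- A rank one (linear) connection on `C`: a holomorphic line bundle with a holomorphic connection,
given over `U i` by `∇ s = ds - a i * s du`. The last condition says that the local expressions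
agree over `U i ∩ U j`, that is `dg i j / g i j = (a i - a j) du`. -/
structure Connection (L : PeriodPair) extends LineBundle L where
  a : ι → Curve L → ℂ
  holomorphic_a : ∀ i, HolomorphicOn L (a i) (U i)
  compatible : ∀ i j, ∀ u ∈ proj L ⁻¹' (U i ∩ U j),
    deriv (fun w => g i j (proj L w)) u = (a i (proj L u) - a j (proj L u)) * g i j (proj L u)

/-- `h` is an isomorphism of line bundles `E → E'`, sending a section `s` to `s'` with
`s' k = h k i * s i`. -/
structure LineBundle.IsIso {L : PeriodPair} (E E' : LineBundle L)
    (h : E'.ι → E.ι → Curve L → ℂ) : Prop where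
  holomorphic : ∀ k i, HolomorphicOn L (h k i) (E'.U k ∩ E.U i)
  ne_zero : ∀ k i, ∀ x ∈ E'.U k ∩ E.U i, h k i x ≠ 0
  compatible : ∀ k l i j, ∀ x ∈ E'.U k ∩ E'.U l ∩ (E.U i ∩ E.U j),
    h k i x * E.g i j x = E'.g k l x * h l j x

/-- Isomorphic line bundles. -/
def LineBundle.Isomorphic {L : PeriodPair} (E E' : LineBundle L) : Prop :=
  ∃ h, LineBundle.IsIso E E' h

/-- Isomorphic connections: there is an isomorphism of line bundles that respects the connections,
that is `dh / h = (a' - a) du`. -/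
def Connection.Isomorphic {L : PeriodPair} (E E' : Connection L) : Prop :=
  ∃ h, LineBundle.IsIso E.toLineBundle E'.toLineBundle h ∧
    ∀ k i, ∀ u ∈ proj L ⁻¹' (E'.U k ∩ E.U i),
      deriv (fun w => h k i (proj L w)) u =
        (E'.a k (proj L u) - E.a i (proj L u)) * h k i (proj L u)

lemma HolomorphicOn.mono {L : PeriodPair} {f : Curve L → ℂ} {U V : Set (Curve L)}
    (hf : HolomorphicOn L f U) (h : V ⊆ U) : HolomorphicOn L f V :=
  DifferentiableOn.mono hf (Set.preimage_mono h)

lemma HolomorphicOn.differentiableAt {L : PeriodPair} {f : Curve L → ℂ} {U : Set (Curve L)}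
    (hf : HolomorphicOn L f U) (hU : IsOpen U) {u : ℂ} (hu : proj L u ∈ U) :
    DifferentiableAt ℂ (fun w => f (proj L w)) u :=
  DifferentiableOn.differentiableAt hf
    ((hU.preimage (isLocalHomeomorph_proj L).continuous).mem_nhds hu)

/-- The tensor product of two connections: transition functions are multiplied, connection forms
are added. -/
def Connection.tensor {L : PeriodPair} (E E' : Connection L) : Connection L where
  ι := E.ι × E'.ι
  U i := E.U i.1 ∩ E'.U i.2
  isOpen_U i := (E.isOpen_U i.1).inter (E'.isOpen_U i.2)
  cover x := by
    obtain ⟨i, hi⟩ := E.cover x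
    obtain ⟨k, hk⟩ := E'.cover x
    exact ⟨(i, k), hi, hk⟩
  g i j x := E.g i.1 j.1 x * E'.g i.2 j.2 x
  holomorphic_g i j :=
    ((E.holomorphic_g i.1 j.1).mono fun _ h => ⟨h.1.1, h.2.1⟩).mul
      ((E'.holomorphic_g i.2 j.2).mono fun _ h => ⟨h.1.2, h.2.2⟩)
  g_ne_zero i j x h :=
    mul_ne_zero (E.g_ne_zero _ _ x ⟨h.1.1, h.2.1⟩) (E'.g_ne_zero _ _ x ⟨h.1.2, h.2.2⟩)
  cocycle i j k x h := by
    rw [← E.cocycle i.1 j.1 k.1 x ⟨⟨h.1.1.1, h.1.2.1⟩, h.2.1⟩,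
      ← E'.cocycle i.2 j.2 k.2 x ⟨⟨h.1.1.2, h.1.2.2⟩, h.2.2⟩]
    ring
  a i x := E.a i.1 x + E'.a i.2 x
  holomorphic_a i :=
    ((E.holomorphic_a i.1).mono fun _ h => h.1).add
      ((E'.holomorphic_a i.2).mono fun _ h => h.2)
  compatible i j u hu := by
    have h₁ := (E.holomorphic_g i.1 j.1).differentiableAt
      ((E.isOpen_U _).inter (E.isOpen_U _)) (u := u) ⟨hu.1.1, hu.2.1⟩
    have h₂ := (E'.holomorphic_g i.2 j.2).differentiableAt
      ((E'.isOpen_U _).inter (E'.isOpen_U _)) (u := u) ⟨hu.1.2, hu.2.2⟩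
    rw [deriv_fun_mul h₁ h₂, E.compatible _ _ u ⟨hu.1.1, hu.2.1⟩,
      E'.compatible _ _ u ⟨hu.1.2, hu.2.2⟩]
    ring

/-! ### Monodromy -/

/-- `s` is a multivalued horizontal section of `E` without zeroes: a horizontal frame of the
pullback of `E` to the universal cover `ℂ → C`. -/
structure Connection.IsHorizontalFrame {L : PeriodPair} (E : Connection L)
    (s : E.ι → ℂ → ℂ) : Prop where
  ne_zero : ∀ i, ∀ u ∈ proj L ⁻¹' E.U i, s i u ≠ 0
  glue : ∀ i j, ∀ u ∈ proj L ⁻¹' (E.U i ∩ E.U j), s i u = E.g i j (proj L u) * s j u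
  horizontal : ∀ i, ∀ u ∈ proj L ⁻¹' E.U i, HasDerivAt (s i) (E.a i (proj L u) * s i u) u

/-- `ρ : Λ = π₁(C) → ℂ*` is the monodromy of `E`: continuation along `γ` multiplies horizontal
sections by `ρ γ`. -/
def Connection.HasMonodromy {L : PeriodPair} (E : Connection L)
    (ρ : Multiplicative L.lattice →* ℂˣ) : Prop :=
  ∃ s, E.IsHorizontalFrame s ∧ ∀ i, ∀ u ∈ proj L ⁻¹' E.U i, ∀ γ : L.lattice,
    s i (u + γ) = ρ (Multiplicative.ofAdd γ) * s i u

/-! ### The parametrization of connections by `A₀` -/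

/-- `E` is the connection `dz / z = f du` in a meromorphic trivialization: there is a meromorphic
section `t` of `E`, not identically zero, such that `z • t` is horizontal if and only if
`dz / z = f du`, that is `dt / t = (a - f) du`. -/
def Connection.HasForm {L : PeriodPair} (E : Connection L) (f : ℂ → ℂ) : Prop :=
  ∃ t : E.ι → Curve L → ℂ,
    (∀ i, MeromorphicOn (fun u => t i (proj L u)) (proj L ⁻¹' E.U i)) ∧
    (∀ i, ∀ u ∈ proj L ⁻¹' E.U i, ∀ᶠ w in 𝓝[≠] u, t i (proj L w) ≠ 0) ∧
    (∀ i j, ∀ u ∈ proj L ⁻¹' (E.U i ∩ E.U j), ∀ᶠ w in 𝓝[≠] u,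
      t i (proj L w) = E.g i j (proj L w) * t j (proj L w)) ∧
    (∀ i, ∀ u ∈ proj L ⁻¹' E.U i, ∀ᶠ w in 𝓝[≠] u,
      deriv (fun v => t i (proj L v)) w = (E.a i (proj L w) - f w) * t i (proj L w))

/-- The function `(℘'(u) + ℘'(u₀)) / (2 (℘(u) - ℘(u₀))) + c` of `u`. -/
def mainForm (L : PeriodPair) (u₀ c u : ℂ) : ℂ :=
  (℘'[L] u + ℘'[L] u₀) / (2 * (℘[L] u - ℘[L] u₀)) + c

/-- The point `p` of `A₀` is a parameter of the connection `E`: either `p = (u₀, c)` with `u₀ ≠ 0`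
and `E` is `dz / z = ((℘'(u) + ℘'(u₀)) / (2 (℘(u) - ℘(u₀))) + c) du`, or `p = (0, c₀)` and `E` is
`dz / z = c₀ du`. -/
def Connection.HasParameter {L : PeriodPair} (E : Connection L) (p : A₀ L) : Prop :=
  (∃ u₀ c : ℂ, u₀ ∉ L.lattice ∧ p = mainPoint L u₀ c ∧ E.HasForm (mainForm L u₀ c)) ∨
    ∃ c₀ : ℂ, p = zeroPoint L c₀ ∧ E.HasForm fun _ => c₀

/-- The multivalued solution `σ(u - u₀) / σ(u) * exp ((ζ(u₀) + c) u)` of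
`dz / z = ((℘'(u) + ℘'(u₀)) / (2 (℘(u) - ℘(u₀))) + c) du`. -/
def solution (L : PeriodPair) (u₀ c u : ℂ) : ℂ :=
  sigma L (u - u₀) / sigma L u * exp ((zeta L u₀ + c) * u)

/-- The first lattice generator. -/
def gen₁ (L : PeriodPair) : L.lattice := ⟨L.ω₁, L.ω₁_mem_lattice⟩

/-- The second lattice generator. -/
def gen₂ (L : PeriodPair) : L.lattice := ⟨L.ω₂, L.ω₂_mem_lattice⟩

end EllipticRH

end

noncomputable section

namespace EllipticRH

/-! ### The Weierstrass zeta and sigma functions -/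

/-! Both sides of the correspondence are the group of characters `Λ → ℂ*`, presented as one and the
same quotient of `ℂ²`.

Pulled back to `ℂ`, a connection has a horizontal frame, unique up to a constant
(`exists_isHorizontalFrame`, `IsFrameOn.exists_eq_const_mul`). Translating the frame by `γ`
multiplies it by `ρ(γ)`. The character `ρ` determines the connection up to isomorphism
(`exists_isIso`, `exists_of_isIso`), and every `ρ` occurs (`flatConnection`).

To `(x, w) ∈ ℂ²` attach the character `γ ↦ exp(wγ - xζ(γ))`, called `chi`. The Legendre relation
`η₁ω₂ - η₂ω₁ = ±2πi` (`legendreDet_eq`) shows that every character arises, and that two pairs give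
the same one exactly when they differ by some `(γ, ζ(γ))`. The map `(x, w) ↦ (x, w - ζ(x))` onto
`A₀` has the same fibres (`point_eq_iff_chi`); the pole of `ζ` at `0` is the gluing term `1/u₀`.
Hence `A₀` is in bijection with the characters, that is with `ℂ* × ℂ*`. The bijection is the
exponential of a linear isomorphism of `ℂ²`, so it is biholomorphic.

The equations defining parameters enter through their multivalued solutions. A connection is `dz/z =
f du` in a meromorphic trivialization if and only if its monodromy is the system of multipliers of a
solution `z` (`HasMonodromy.hasForm`, `HasForm.hasMonodromy`). The sigma quotient `solution` has
multipliers `chi L u₀ (c + ζ(u₀))`, by the addition formula `zeta_sub` and the quasi-periodicity of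
`σ`. So having parameter `p` means having monodromy `character L p` (`hasParameter_iff`). Underlying
line bundles are isomorphic when characters differ by some `exp(aγ)`, which moves `w` and leaves `x`
fixed modulo `Λ`. A holomorphic section of `A₀` would give nonvanishing elliptic functions without
poles, hence constants, against injectivity. -/

lemma norm_zeta_term_le {r : ℝ} (hr : 0 < r) {z : ℂ} (hz : ‖z‖ < r) {l : ℂ} (h : 2 * r ≤ ‖l‖) :
    ‖1 / (z - l) + 1 / l + z / l ^ 2‖ ≤ 2 * r ^ 2 * ‖l‖ ^ (-3 : ℝ) := by
  have hl : 0 < ‖l‖ := by linarith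
  have hl0 : l ≠ 0 := norm_pos_iff.1 hl
  have hzl : ‖l‖ / 2 ≤ ‖z - l‖ := by
    rw [norm_sub_rev]
    exact .trans (by linarith) (norm_sub_norm_le l z)
  have hzl0 : z - l ≠ 0 := norm_pos_iff.1 (by linarith)
  -- The counterterms cancel the expansion of `1 / (z - l)` through first order in `z`, which leaves
  -- cubic decay in `l`.
  have e : 1 / (z - l) + 1 / l + z / l ^ 2 = z ^ 2 / ((z - l) * l ^ 2) := by
    field_simp
    ring
  rw [e, norm_div, norm_mul, norm_pow, norm_pow]
  calc ‖z‖ ^ 2 / (‖z - l‖ * ‖l‖ ^ 2) ≤ r ^ 2 / (‖l‖ / 2 * ‖l‖ ^ 2) := by gcongr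
    _ = 2 * r ^ 2 / ‖l‖ ^ 3 := by field_simp
    _ = _ := by norm_cast

lemma hasSumLocallyUniformly_zeta (L : PeriodPair) :
    HasSumLocallyUniformly
      (fun (l : L.lattice) (z : ℂ) ↦ 1 / (z - l) + 1 / (l : ℂ) + z / (l : ℂ) ^ 2) (zeta L) := by
  refine L.hasSumLocallyUniformly_aux (u := fun r l ↦ 2 * r ^ 2 * ‖l‖ ^ (-3 : ℝ)) _
    (fun _ _ ↦ (ZLattice.summable_norm_rpow _ _ (by simp; norm_num)).mul_left _) fun r hr ↦
    Filter.eventually_atTop.mpr ⟨2 * r, ?_⟩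
  rintro _ h s hs l rfl
  exact norm_zeta_term_le hr hs h

lemma hasSum_zeta (L : PeriodPair) (z : ℂ) :
    HasSum (fun l : L.lattice ↦ 1 / (z - l) + 1 / (l : ℂ) + z / (l : ℂ) ^ 2) (zeta L z) :=
  (hasSumLocallyUniformly_zeta L).hasSum

lemma isOpen_compl_lattice (L : PeriodPair) : IsOpen ((L.lattice : Set ℂ)ᶜ) :=
  L.isClosed_lattice.isOpen_compl

/-- A countable set does not disconnect the plane. Functions with zero derivative off the lattice
are therefore constant there. -/
lemma isPreconnected_compl_lattice (L : PeriodPair) :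
    IsPreconnected ((L.lattice : Set ℂ)ᶜ) := by
  refine (Set.Countable.isConnected_compl_of_one_lt_rank ?_ ?_).isPreconnected
  · rw [rank_real_complex]; exact Nat.one_lt_ofNat
  · have : Countable L.lattice := L.latticeEquivProd.toEquiv.countable_iff.2 inferInstance
    exact Set.to_countable _

lemma sub_ne_zero_of_notMem {L : PeriodPair} {z : ℂ} (hz : z ∉ L.lattice) (l : L.lattice) :
    z - l ≠ 0 := by
  intro h
  rw [sub_eq_zero] at h
  exact hz (h ▸ l.2)

/-- Locally uniform convergence allows termwise differentiation, and the differentiated series is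
the one for `-℘`. -/
lemma hasDerivAt_zeta (L : PeriodPair) {z : ℂ} (hz : z ∉ L.lattice) :
    HasDerivAt (zeta L) (-℘[L] z) z := by
  have hd : ∀ w ∈ (L.lattice : Set ℂ)ᶜ, ∀ l : L.lattice,
      HasDerivAt (fun z : ℂ ↦ 1 / (z - l) + 1 / (l : ℂ) + z / (l : ℂ) ^ 2)
        (-(1 / (w - l) ^ 2 - 1 / (l : ℂ) ^ 2)) w := by
    intro w hw l
    have h := sub_ne_zero_of_notMem hw l
    have h1 : HasDerivAt (fun z : ℂ ↦ 1 / (z - l)) (-1 / (w - l) ^ 2) w := by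
      simpa using ((hasDerivAt_id w).sub_const (l : ℂ)).fun_inv h
    convert! (h1.add_const (1 / (l : ℂ))).add ((hasDerivAt_id w).div_const ((l : ℂ) ^ 2)) using 1
    ring
  have hs : ∀ᶠ s : Finset L.lattice in atTop, DifferentiableOn ℂ
      (fun z ↦ ∑ l ∈ s, (1 / (z - l) + 1 / (l : ℂ) + z / (l : ℂ) ^ 2)) (L.lattice : Set ℂ)ᶜ :=
    .of_forall fun s w hw ↦
      (HasDerivAt.fun_sum fun l _ ↦ hd w hw l).differentiableAt.differentiableWithinAt
  have hlim := (hasSumLocallyUniformly_zeta L).tendstoLocallyUniformlyOn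
    (s := (L.lattice : Set ℂ)ᶜ)
  have hdiff := (hlim.differentiableOn hs (isOpen_compl_lattice L)).differentiableAt
    ((isOpen_compl_lattice L).mem_nhds hz)
  have h1 := (hlim.deriv hs (isOpen_compl_lattice L)).tendsto_at hz
  have h2 : Tendsto (fun s : Finset L.lattice ↦
      ∑ l ∈ s, (-(1 / (z - l) ^ 2 - 1 / (l : ℂ) ^ 2))) atTop (𝓝 (-℘[L] z)) :=
    (L.hasSum_weierstrassP z).neg
  have h3 : deriv (zeta L) z = -℘[L] z := by
    refine tendsto_nhds_unique h1 (h2.congr fun s ↦ ?_)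
    exact (HasDerivAt.fun_sum fun l _ ↦ hd z hz l).deriv.symm
  exact h3 ▸ hdiff.hasDerivAt

lemma eqOn_const_of_hasDerivAt_zero {L : PeriodPair} {f : ℂ → ℂ}
    (hf : ∀ z ∉ L.lattice, HasDerivAt f 0 z) {z w : ℂ} (hz : z ∉ L.lattice) (hw : w ∉ L.lattice) :
    f z = f w :=
  (isOpen_compl_lattice L).is_const_of_deriv_eq_zero (isPreconnected_compl_lattice L)
    (fun z hz ↦ (hf z hz).differentiableAt.differentiableWithinAt)
    (fun z hz ↦ (hf z hz).deriv) hz hw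

lemma add_notMem {L : PeriodPair} {z : ℂ} (hz : z ∉ L.lattice) (γ : L.lattice) :
    z + γ ∉ L.lattice := fun h ↦ hz (by simpa using sub_mem h γ.2)

/-- The increment of `ζ` has derivative zero because `℘` is periodic, so its value at `ω₁ / 2` is
its value everywhere off the lattice. -/
lemma zeta_add (L : PeriodPair) {z : ℂ} (hz : z ∉ L.lattice) (γ : L.lattice) :
    zeta L (z + γ) = zeta L z + quasiPeriod L γ := by
  have h : ∀ z ∉ L.lattice, HasDerivAt (fun z ↦ zeta L (z + γ) - zeta L z) 0 z := by
    intro z hz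
    convert! ((hasDerivAt_zeta L (add_notMem hz γ)).comp_add_const z (γ : ℂ)).sub
      (hasDerivAt_zeta L hz) using 1
    rw [L.weierstrassP_add_coe, sub_self]
  have := eqOn_const_of_hasDerivAt_zero h hz L.ω₁_div_two_notMem_lattice
  rw [quasiPeriod, ← this]
  ring

lemma quasiPeriod_add (L : PeriodPair) (γ δ : L.lattice) :
    quasiPeriod L (γ + δ) = quasiPeriod L γ + quasiPeriod L δ := by
  have h0 := L.ω₁_div_two_notMem_lattice
  have h1 := zeta_add L h0 (γ + δ)
  have h2 := zeta_add L (add_notMem h0 γ) δ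
  rw [zeta_add L h0 γ, add_assoc] at h2
  rw [Submodule.coe_add, h2] at h1
  linear_combination -h1

/-- The quasi-periods as a homomorphism. -/
def quasiPeriodHom (L : PeriodPair) : L.lattice →+ ℂ :=
  AddMonoidHom.mk' (quasiPeriod L) (quasiPeriod_add L)

lemma quasiPeriod_zero (L : PeriodPair) : quasiPeriod L 0 = 0 := (quasiPeriodHom L).map_zero

/-- The elementary factor `(1 - w) exp (w + w² / 2)`. -/
def elementaryFactor (w : ℂ) : ℂ := (1 - w) * exp (w + w ^ 2 / 2)

lemma hasDerivAt_elementaryFactor (w : ℂ) :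
    HasDerivAt elementaryFactor (-w ^ 2 * exp (w + w ^ 2 / 2)) w := by
  have h1 : HasDerivAt (fun w : ℂ ↦ w + w ^ 2 / 2) (1 + w) w := by
    convert! (hasDerivAt_id w).add ((hasDerivAt_pow 2 w).div_const 2) using 1
    simp
  convert! ((hasDerivAt_id w).const_sub 1).mul h1.cexp using 1
  simp only [id]
  ring

/-- Mean value inequality on the disc of radius `‖w‖`: the derivative `-v² exp(v + v²/2)` is already
quadratic in `v`, and the exponent has modulus at most `3/2`. -/
lemma norm_elementaryFactor_sub_one_le {w : ℂ} (hw : ‖w‖ ≤ 1) :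
    ‖elementaryFactor w - 1‖ ≤ Real.exp 2 * ‖w‖ ^ 3 := by
  have h := (convex_closedBall (0 : ℂ) ‖w‖).norm_image_sub_le_of_norm_hasDerivWithin_le
    (f := elementaryFactor) (C := Real.exp 2 * ‖w‖ ^ 2) (x := 0) (y := w)
    (fun v _ ↦ (hasDerivAt_elementaryFactor v).hasDerivWithinAt) ?_ (by simp) (by simp)
  · simp only [elementaryFactor, sub_zero] at h ⊢
    simp only [ne_eq, OfNat.ofNat_ne_zero, not_false_eq_true, zero_pow, zero_div, add_zero,
      exp_zero, mul_one] at h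
    linarith
  · intro v hv
    have hv : ‖v‖ ≤ ‖w‖ := by simpa using hv
    have hv1 : ‖v‖ ≤ 1 := hv.trans hw
    rw [norm_mul, norm_neg, norm_pow, mul_comm]
    gcongr
    rw [norm_exp]
    gcongr
    refine (re_le_norm _).trans ((norm_add_le _ _).trans ?_)
    rw [norm_div, norm_pow]
    have : ‖v‖ ^ 2 ≤ 1 := pow_le_one₀ (norm_nonneg _) hv1
    norm_num
    linarith

/-- The Weierstrass sigma function divided by its argument. -/
def sigmaQuot (L : PeriodPair) (z : ℂ) : ℂ := ∏' l : L.lattice, elementaryFactor (z / (l : ℂ))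

lemma sigma_eq (L : PeriodPair) (z : ℂ) : sigma L z = z * sigmaQuot L z := by
  unfold sigma sigmaQuot elementaryFactor
  congr! 5 with l
  rw [div_pow]
  ring

lemma summable_norm_elementaryFactor (L : PeriodPair) (r : ℝ) :
    (Summable fun l : L.lattice ↦ Real.exp 2 * r ^ 3 * ‖l‖ ^ (-3 : ℝ)) ∧
    ∀ᶠ l : L.lattice in cofinite, ∀ z ∈ Metric.ball (0 : ℂ) r,
      ‖elementaryFactor (z / (l : ℂ)) - 1‖ ≤ Real.exp 2 * r ^ 3 * ‖l‖ ^ (-3 : ℝ) := by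
  refine ⟨(ZLattice.summable_norm_rpow _ _ (by simp; norm_num)).mul_left _, ?_⟩
  refine (isCompact_iff_finite.mp (isCompact_closedBall (0 : L.lattice) r)).subset ?_
  intro l hl
  simp only [Metric.mem_closedBall, dist_zero_right]
  contrapose! hl
  simp only [Set.mem_compl_iff, Set.mem_ofPred_eq, not_not, Metric.mem_ball, dist_zero_right]
  intro z hz
  have hr : 0 < r := (norm_nonneg z).trans_lt hz
  have hl0 : 0 < ‖(l : ℂ)‖ := hr.trans hl
  have hl' : r < ‖(l : ℂ)‖ := hl
  have hq : ‖z / (l : ℂ)‖ ≤ r / ‖(l : ℂ)‖ := by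
    rw [norm_div]; gcongr
  refine (norm_elementaryFactor_sub_one_le (hq.trans ((div_le_one hl0).2 hl'.le))).trans ?_
  calc Real.exp 2 * ‖z / (l : ℂ)‖ ^ 3 ≤ Real.exp 2 * (r / ‖(l : ℂ)‖) ^ 3 := by gcongr
    _ = Real.exp 2 * r ^ 3 / ‖(l : ℂ)‖ ^ 3 := by rw [div_pow]; ring
    _ = _ := by norm_cast

lemma differentiable_elementaryFactor : Differentiable ℂ elementaryFactor :=
  fun w ↦ (hasDerivAt_elementaryFactor w).differentiableAt

lemma hasProdLocallyUniformlyOn_sigmaQuot (L : PeriodPair) (r : ℝ) :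
    HasProdLocallyUniformlyOn (fun (l : L.lattice) z ↦ elementaryFactor (z / (l : ℂ)))
      (sigmaQuot L) (Metric.ball 0 r) := by
  have h := summable_norm_elementaryFactor L r
  have := h.1.hasProdLocallyUniformlyOn_one_add Metric.isOpen_ball h.2
    (fun l ↦ ((differentiable_elementaryFactor.continuous.comp
      (continuous_id.div_const (l : ℂ))).sub continuous_const).continuousOn)
  simpa [Function.comp_def] using! this

lemma differentiable_sigmaQuot (L : PeriodPair) : Differentiable ℂ (sigmaQuot L) := by
  intro z
  have h := (hasProdLocallyUniformlyOn_sigmaQuot L (‖z‖ + 1)).differentiableOn ?_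
    Metric.isOpen_ball
  · exact h.differentiableAt (Metric.isOpen_ball.mem_nhds (by simp))
  · refine .of_forall fun s ↦ ?_
    refine (Differentiable.fun_finsetProd fun l _ ↦ ?_).differentiableOn
    exact differentiable_elementaryFactor.comp (differentiable_id.div_const (l : ℂ))

lemma differentiable_sigma (L : PeriodPair) : Differentiable ℂ (sigma L) := by
  have : sigma L = fun z ↦ z * sigmaQuot L z := funext (sigma_eq L)
  rw [this]
  exact differentiable_id.mul (differentiable_sigmaQuot L)

lemma elementaryFactor_ne_zero {w : ℂ} (h : w ≠ 1) : elementaryFactor w ≠ 0 :=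
  mul_ne_zero (sub_ne_zero.2 h.symm) (exp_ne_zero _)

lemma elementaryFactor_lattice_ne_zero {L : PeriodPair} {z : ℂ} (hz : z ∉ L.lattice)
    (l : L.lattice) : elementaryFactor (z / (l : ℂ)) ≠ 0 := by
  refine elementaryFactor_ne_zero fun h ↦ ?_
  have hl : (l : ℂ) ≠ 0 := by
    intro h0
    simp [h0] at h
  rw [div_eq_one_iff_eq hl] at h
  exact hz (h ▸ l.2)

lemma sigmaQuot_zero (L : PeriodPair) : sigmaQuot L 0 = 1 := by
  simp [sigmaQuot, elementaryFactor]

lemma sigma_zero (L : PeriodPair) : sigma L 0 = 0 := by simp [sigma_eq]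

lemma sigmaQuot_ne_zero {L : PeriodPair} {z : ℂ} (hz : z ∉ L.lattice) : sigmaQuot L z ≠ 0 := by
  have h := summable_norm_elementaryFactor L (‖z‖ + 1)
  have h2 : Summable fun l : L.lattice ↦ ‖elementaryFactor (z / (l : ℂ)) - 1‖ := by
    refine (h.1.of_norm_bounded_eventually (h.2.mono fun l hl ↦ ?_))
    simpa using hl z (by simp)
  have := tprod_one_add_ne_zero_of_summable (f := fun l : L.lattice ↦
    elementaryFactor (z / (l : ℂ)) - 1) (fun l ↦ ?_) h2
  · simpa [sigmaQuot] using this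
  · simpa using elementaryFactor_lattice_ne_zero hz l

lemma ne_zero_of_notMem {L : PeriodPair} {z : ℂ} (hz : z ∉ L.lattice) : z ≠ 0 := by
  rintro rfl
  exact hz (zero_mem _)

lemma sigma_ne_zero {L : PeriodPair} {z : ℂ} (hz : z ∉ L.lattice) : sigma L z ≠ 0 := by
  rw [sigma_eq]
  exact mul_ne_zero (ne_zero_of_notMem hz) (sigmaQuot_ne_zero hz)

lemma sigmaQuot_neg (L : PeriodPair) (z : ℂ) : sigmaQuot L (-z) = sigmaQuot L z := by
  rw [sigmaQuot, sigmaQuot, ← (Equiv.neg L.lattice).tprod_eq]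
  simp

lemma sigma_neg (L : PeriodPair) (z : ℂ) : sigma L (-z) = -sigma L z := by
  rw [sigma_eq, sigma_eq, sigmaQuot_neg]
  ring

/-- With division by zero, the factor `l = 0` is the constant `1` while the zeta term `l = 0` is `1
/ z`; the `if` accounts for the difference. -/
lemma logDeriv_elementaryFactor {L : PeriodPair} {z : ℂ} (hz : z ∉ L.lattice) (l : L.lattice) :
    logDeriv (fun z ↦ elementaryFactor (z / (l : ℂ))) z =
      (1 / (z - l) + 1 / (l : ℂ) + z / (l : ℂ) ^ 2) - if l = 0 then 1 / z else 0 := by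
  have h1 := (hasDerivAt_elementaryFactor (z / (l : ℂ))).comp z
    ((hasDerivAt_id z).div_const (l : ℂ))
  rw [logDeriv_apply, show (fun z ↦ elementaryFactor (z / (l : ℂ))) =
    elementaryFactor ∘ fun z ↦ id z / (l : ℂ) from rfl, h1.deriv]
  split_ifs with h
  · simp [h]
  · have hl : (l : ℂ) ≠ 0 := by simpa using h
    have hzl := sub_ne_zero_of_notMem hz l
    have hzl' : (l : ℂ) - z ≠ 0 := by rw [← neg_sub]; exact neg_ne_zero.2 hzl
    have he := exp_ne_zero (z / (l : ℂ) + (z / (l : ℂ)) ^ 2 / 2)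
    rw [elementaryFactor, div_eq_iff (mul_ne_zero ?_ he)]
    · field_simp
      ring
    · have : 1 - z / (l : ℂ) = (l - z) / l := by field_simp
      rw [this]
      exact div_ne_zero hzl' hl

lemma logDeriv_sigmaQuot {L : PeriodPair} {z : ℂ} (hz : z ∉ L.lattice) :
    logDeriv (sigmaQuot L) z = zeta L z - 1 / z := by
  have hs : HasSum (fun l : L.lattice ↦ logDeriv (fun z ↦ elementaryFactor (z / (l : ℂ))) z)
      (zeta L z - 1 / z) := by
    simp_rw [logDeriv_elementaryFactor hz]
    exact (hasSum_zeta L z).sub (hasSum_ite_eq 0 (1 / z))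
  have := logDeriv_tprod_eq_tsum (Metric.isOpen_ball (x := (0 : ℂ)) (ε := ‖z‖ + 1)) (x := z)
    (by simp) (f := fun (l : L.lattice) z ↦ elementaryFactor (z / (l : ℂ)))
    (elementaryFactor_lattice_ne_zero hz)
    (fun l ↦ (differentiable_elementaryFactor.comp
      (differentiable_id.div_const (l : ℂ))).differentiableOn) hs.summable
    ⟨_, hasProdLocallyUniformlyOn_sigmaQuot L _⟩ (sigmaQuot_ne_zero hz)
  exact this.trans hs.tsum_eq

lemma hasDerivAt_sigma {L : PeriodPair} {z : ℂ} (hz : z ∉ L.lattice) :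
    HasDerivAt (sigma L) (zeta L z * sigma L z) z := by
  have h1 := logDeriv_sigmaQuot hz
  have h0 := ne_zero_of_notMem hz
  rw [logDeriv_apply, div_eq_iff (sigmaQuot_ne_zero hz)] at h1
  have : sigma L = fun z ↦ z * sigmaQuot L z := funext (sigma_eq L)
  rw [this]
  convert! (hasDerivAt_id z).mul (differentiable_sigmaQuot L z).hasDerivAt using 1
  rw [h1]
  simp only [id]
  field_simp
  ring

lemma sigma_coe (L : PeriodPair) (γ : L.lattice) : sigma L γ = 0 := by
  rw [sigma_eq]
  by_cases h : (γ : ℂ) = 0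
  · rw [h, zero_mul]
  · rw [sigmaQuot, tprod_of_exists_eq_zero, mul_zero]
    exact ⟨γ, by simp [elementaryFactor, div_self h]⟩

/-- The factor of quasi-periodicity of the sigma function. -/
lemma exists_sigma_add (L : PeriodPair) (γ : L.lattice) :
    ∃ C : ℂ, C ≠ 0 ∧ ∀ z, sigma L (z + γ) = C * exp (quasiPeriod L γ * z) * sigma L z := by
  -- The logarithmic derivative of this quotient is `ζ(z + γ) - ζ(γ) - ζ(z) = 0`.
  have h : ∀ z ∉ L.lattice, HasDerivAt
      (fun z ↦ sigma L (z + γ) / (exp (quasiPeriod L γ * z) * sigma L z)) 0 z := by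
    intro z hz
    have h1 := (hasDerivAt_sigma (add_notMem hz γ)).comp_add_const z (γ : ℂ)
    have h2 := (((hasDerivAt_id z).const_mul (quasiPeriod L γ)).cexp.mul (hasDerivAt_sigma hz))
    have h3 := mul_ne_zero (exp_ne_zero (quasiPeriod L γ * z)) (sigma_ne_zero hz)
    convert! h1.div h2 h3 using 1
    simp only [id, zeta_add L hz, Pi.mul_apply]
    field_simp
    ring
  have h0 := L.ω₁_div_two_notMem_lattice
  refine ⟨_, div_ne_zero (sigma_ne_zero (add_notMem h0 γ))
    (mul_ne_zero (exp_ne_zero (quasiPeriod L γ * (L.ω₁ / 2))) (sigma_ne_zero h0)), fun z ↦ ?_⟩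
  by_cases hz : z ∈ L.lattice
  · have e1 := sigma_coe L ⟨z, hz⟩
    have e2 := sigma_coe L (⟨z, hz⟩ + γ)
    simp only [Submodule.coe_add] at e1 e2
    rw [e1, e2, mul_zero]
  · have h3 := mul_ne_zero (exp_ne_zero (quasiPeriod L γ * z)) (sigma_ne_zero hz)
    rw [← eqOn_const_of_hasDerivAt_zero h hz h0, mul_assoc, div_mul_cancel₀ _ h3]

/-- The Legendre relation modulo `2πi`. -/
lemma exp_legendre (L : PeriodPair) (γ δ : L.lattice) :
    exp (quasiPeriod L γ * δ - quasiPeriod L δ * γ) = 1 := by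
  obtain ⟨C, hC, h⟩ := exists_sigma_add L γ
  obtain ⟨D, hD, h'⟩ := exists_sigma_add L δ
  have h0 := L.ω₁_div_two_notMem_lattice
  -- The value of `σ` at `ω₁ / 2 + γ + δ` is computed in the two possible orders of translation.
  have h1 := h (L.ω₁ / 2 + δ)
  have h2 := h' (L.ω₁ / 2 + γ)
  rw [add_right_comm, h2, h, h', mul_add, mul_add, exp_add, exp_add] at h1
  have hs := sigma_ne_zero h0
  rw [exp_sub, div_eq_one_iff_eq (exp_ne_zero _)]
  have e1 := exp_ne_zero (quasiPeriod L γ * (L.ω₁ / 2))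
  have e2 := exp_ne_zero (quasiPeriod L δ * (L.ω₁ / 2))
  have hne : C * D * exp (quasiPeriod L γ * (L.ω₁ / 2)) * exp (quasiPeriod L δ * (L.ω₁ / 2)) *
    sigma L (L.ω₁ / 2) ≠ 0 := by positivity
  apply mul_left_cancel₀ hne
  linear_combination -h1

/-! ### Liouville's theorem for elliptic functions -/

lemma exists_norm_sub_lattice_le (L : PeriodPair) :
    ∃ R : ℝ, ∀ z : ℂ, ∃ γ : L.lattice, ‖z - γ‖ ≤ R := by
  refine ⟨∑ i, ‖L.basis i‖, fun z ↦ ⟨⟨ZSpan.floor L.basis z, ?_⟩, ZSpan.norm_fract_le L.basis z⟩⟩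
  rw [L.lattice_eq_span_range_basis]
  exact (ZSpan.floor L.basis z).2

/-- An entire function whose modulus is doubly periodic is constant. -/
lemma eq_const_of_norm_periodic {L : PeriodPair} {f : ℂ → ℂ} (hf : Differentiable ℂ f)
    (h : ∀ z, ∀ γ : L.lattice, ‖f (z + γ)‖ = ‖f z‖) (z w : ℂ) : f z = f w := by
  obtain ⟨R, hR⟩ := exists_norm_sub_lattice_le L
  obtain ⟨B, hB⟩ := (isCompact_closedBall (0 : ℂ) R).exists_bound_of_continuousOn
    hf.continuous.continuousOn
  refine hf.apply_eq_apply_of_bounded ((Metric.isBounded_closedBall (x := 0) (r := B)).subset ?_) z w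
  rintro _ ⟨v, rfl⟩
  obtain ⟨γ, hγ⟩ := hR v
  have := h (v - γ) γ
  rw [sub_add_cancel] at this
  rw [mem_closedBall_zero_iff, this]
  exact hB _ (by simpa using hγ)

/-- A doubly periodic function with holomorphic extension to the lattice points is constant. -/
lemma eq_const_of_periodic {L : PeriodPair} {f : ℂ → ℂ}
    (hd : ∀ z ∉ L.lattice, DifferentiableAt ℂ f z)
    (hper : ∀ z ∉ L.lattice, ∀ γ : L.lattice, f (z + γ) = f z)
    {g : ℂ → ℂ} (hg : AnalyticAt ℂ g 0) (hfg : ∀ᶠ z in 𝓝[≠] 0, f z = g z) :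
    ∀ z ∉ L.lattice, f z = g 0 := by
  classical
  set F : ℂ → ℂ := fun z ↦ if z ∈ L.lattice then g 0 else f z with hF
  have hFz : ∀ z ∉ L.lattice, F z = f z := fun z hz ↦ if_neg hz
  have hF0 : F 0 = g 0 := if_pos (zero_mem _)
  have hFper : ∀ z, ∀ γ : L.lattice, F (z + γ) = F z := by
    intro z γ
    by_cases hz : z ∈ L.lattice
    · simp only [hF, hz, if_true, L.lattice.add_mem hz γ.2]
    · rw [hFz z hz, hFz _ (add_notMem hz γ), hper z hz]
  have hFg : F =ᶠ[𝓝 0] g := by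
    have h1 : ∀ᶠ z in 𝓝 (0 : ℂ), z ∉ (L.lattice : Set ℂ) \ {0} :=
      L.compl_lattice_sdiff_singleton_mem_nhds 0
    filter_upwards [h1, eventually_nhdsWithin_iff.1 hfg] with z hz1 hz2
    by_cases hz : z = 0
    · rw [hz, hF0]
    · rw [hFz z fun h ↦ hz1 ⟨h, hz⟩, hz2 hz]
  have hFd : Differentiable ℂ F := by
    intro z
    by_cases hz : z ∈ L.lattice
    · have h1 : DifferentiableAt ℂ F (z + ((-⟨z, hz⟩ : L.lattice) : ℂ)) := by
        simpa using hg.differentiableAt.congr_of_eventuallyEq hFg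
      have h2 : DifferentiableAt ℂ (fun w ↦ F (w + ((-⟨z, hz⟩ : L.lattice) : ℂ))) z :=
        h1.comp z (differentiableAt_id.add_const _)
      simpa only [hFper] using h2
    · refine (hd z hz).congr_of_eventuallyEq ?_
      filter_upwards [(isOpen_compl_lattice L).mem_nhds hz] with w hw using hFz w hw
  intro z hz
  rw [← hFz z hz, ← hF0]
  exact eq_const_of_norm_periodic hFd (fun z γ ↦ by rw [hFper]) z 0

/-! ### The addition formula -/

lemma analyticAt_sigmaQuot (L : PeriodPair) (z : ℂ) : AnalyticAt ℂ (sigmaQuot L) z :=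
  (differentiable_sigmaQuot L).analyticAt z

/-- An even analytic function is `f 0 + z² h z` near `0`. -/
lemma exists_analyticAt_of_even {f : ℂ → ℂ} (hf : AnalyticAt ℂ f 0) (he : ∀ z, f (-z) = f z) :
    ∃ h : ℂ → ℂ, AnalyticAt ℂ h 0 ∧ ∀ᶠ z in 𝓝[≠] (0 : ℂ), (f z - f 0) / z ^ 2 = h z := by
  have h1 : AnalyticAt ℂ (dslope f 0) 0 := by
    obtain ⟨p, hp⟩ := hf
    exact ⟨_, hp.has_fpower_series_dslope_fslope⟩
  have h2 : AnalyticAt ℂ (dslope (dslope f 0) 0) 0 := by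
    obtain ⟨p, hp⟩ := h1
    exact ⟨_, hp.has_fpower_series_dslope_fslope⟩
  refine ⟨_, h2, ?_⟩
  have hodd : deriv f 0 = 0 := by
    have h3 : HasDerivAt f (deriv f 0) (-0) := by simpa using hf.differentiableAt.hasDerivAt
    have h4 : HasDerivAt (fun z ↦ f (-z)) (deriv f 0 * -1) 0 := h3.comp 0 (hasDerivAt_neg 0)
    simp_rw [he] at h4
    have := h4.unique hf.differentiableAt.hasDerivAt
    linear_combination -this / 2
  filter_upwards [self_mem_nhdsWithin] with z hz
  have hz : z ≠ 0 := hz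
  rw [dslope_of_ne _ hz, slope_def_field, dslope_of_ne _ hz, dslope_same, hodd, slope_def_field]
  field_simp
  ring

lemma eventually_notMem_lattice (L : PeriodPair) (z : ℂ) : ∀ᶠ w in 𝓝[≠] z, w ∉ L.lattice := by
  have h1 : ∀ᶠ w in 𝓝 z, w ∉ (L.lattice : Set ℂ) \ {z} :=
    L.compl_lattice_sdiff_singleton_mem_nhds z
  rw [eventually_nhdsWithin_iff]
  filter_upwards [h1] with w hw hwz hwl using hw ⟨hwl, hwz⟩

/-- For fixed `v`, the function `σ(u-v)σ(u+v)/σ(u)² + σ(v)²℘(u)` is elliptic in `u`. Its double pole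
at `0` cancels, and evenness excludes a simple one, so it is constant; `u = v` gives the constant.
-/
lemma sigma_mul_sigma {L : PeriodPair} {u v : ℂ} (hu : u ∉ L.lattice) (hv : v ∉ L.lattice) :
    sigma L (u - v) * sigma L (u + v) =
      sigma L u ^ 2 * sigma L v ^ 2 * (℘[L] v - ℘[L] u) := by
  set N : ℂ → ℂ := fun z ↦ sigma L (z - v) * sigma L (z + v) / sigmaQuot L z ^ 2 with hN
  have hσv := sigma_ne_zero hv
  have hNa : AnalyticAt ℂ N 0 := by
    refine AnalyticAt.div ?_ ((analyticAt_sigmaQuot L 0).pow 2) (by simp [sigmaQuot_zero])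
    have h := differentiable_sigma L
    exact Differentiable.analyticAt (by fun_prop) 0
  have hNe : ∀ z, N (-z) = N z := by
    intro z
    simp only [hN]
    rw [sigmaQuot_neg, show -z - v = -(z + v) by ring, show -z + v = -(z - v) by ring, sigma_neg,
      sigma_neg]
    ring
  have hN0 : N 0 = -sigma L v ^ 2 := by
    simp only [hN, sigmaQuot_zero, zero_sub, zero_add, sigma_neg]
    ring
  obtain ⟨h, hh, hNh⟩ := exists_analyticAt_of_even hNa hNe
  have hP := L.analyticAt_weierstrassPExcept 0
  have key := eq_const_of_periodic (L := L)
    (f := fun z ↦ sigma L (z - v) * sigma L (z + v) / sigma L z ^ 2 + sigma L v ^ 2 * ℘[L] z)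
    (g := fun z ↦ h z + sigma L v ^ 2 * L.weierstrassPExcept 0 z) ?_ ?_ (hh.add (analyticAt_const.mul hP)) ?_
  · have hk : sigma L (u - v) * sigma L (u + v) / sigma L u ^ 2 + sigma L v ^ 2 * ℘[L] u =
        sigma L (v - v) * sigma L (v + v) / sigma L v ^ 2 + sigma L v ^ 2 * ℘[L] v :=
      (key u hu).trans (key v hv).symm
    have hσu := sigma_ne_zero hu
    rw [sub_self, sigma_zero, zero_mul, zero_div, zero_add] at hk
    field_simp at hk
    linear_combination hk
  · intro z hz
    have h1 : DifferentiableAt ℂ ℘[L] z := (L.analyticOnNhd_weierstrassP z hz).differentiableAt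
    have h := differentiable_sigma L
    refine DifferentiableAt.add (.div (by fun_prop) (by fun_prop) ?_) (by fun_prop)
    exact pow_ne_zero 2 (sigma_ne_zero hz)
  · intro z hz γ
    obtain ⟨C, hC, hσ⟩ := exists_sigma_add L γ
    have e := exp_ne_zero (quasiPeriod L γ * z)
    have e' := exp_ne_zero (quasiPeriod L γ * v)
    have hσz := sigma_ne_zero hz
    rw [L.weierstrassP_add_coe, show z + γ - v = z - v + γ by ring,
      show z + γ + v = z + v + γ by ring, hσ, hσ, hσ, mul_sub, mul_add, exp_sub, exp_add]
    field_simp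
  · filter_upwards [hNh, eventually_notMem_lattice L 0] with z hz1 hz2
    have hz0 := ne_zero_of_notMem hz2
    have hs := sigmaQuot_ne_zero hz2
    have h0 := L.weierstrassPExcept_def 0 z
    simp only [ZeroMemClass.coe_zero, ne_eq, OfNat.ofNat_ne_zero, not_false_eq_true, zero_pow,
      div_zero, sub_zero] at h0
    rw [← hz1, h0, hN0]
    simp only [hN, sigma_eq L z]
    field_simp
    ring

lemma hasDerivAt_weierstrassP {L : PeriodPair} {z : ℂ} (hz : z ∉ L.lattice) :
    HasDerivAt ℘[L] (℘'[L] z) z := by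
  rw [← L.deriv_weierstrassP]
  exact (L.analyticOnNhd_weierstrassP z hz).differentiableAt.hasDerivAt

lemma sub_notMem_of_weierstrassP_ne {L : PeriodPair} {u v : ℂ} (h : ℘[L] u ≠ ℘[L] v) :
    u - v ∉ L.lattice := by
  intro hm
  apply h
  have := L.weierstrassP_add_coe v ⟨u - v, hm⟩
  simpa using this

lemma add_notMem_of_weierstrassP_ne {L : PeriodPair} {u v : ℂ} (h : ℘[L] u ≠ ℘[L] v) :
    u + v ∉ L.lattice := by
  rw [← sub_neg_eq_add]
  exact sub_notMem_of_weierstrassP_ne (by rwa [L.weierstrassP_neg])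

/-- The addition formula of the zeta function. -/
lemma zeta_sub {L : PeriodPair} {u v : ℂ} (hu : u ∉ L.lattice) (hv : v ∉ L.lattice)
    (h : ℘[L] u ≠ ℘[L] v) :
    zeta L (u - v) = zeta L u - zeta L v + (℘'[L] u + ℘'[L] v) / (2 * (℘[L] u - ℘[L] v)) := by
  have hm := sub_notMem_of_weierstrassP_ne h
  have hp := add_notMem_of_weierstrassP_ne h
  have hne := sub_ne_zero.2 h
  have hσu := sigma_ne_zero hu
  have hσv := sigma_ne_zero hv
  have E := sigma_mul_sigma hu hv
  -- `Eu` and `Ev` are `sigma_mul_sigma` differentiated in `u` and in `v`; their difference isolates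
  -- `ζ(u - v)`.
  have Eu : (zeta L (u - v) + zeta L (u + v)) * (sigma L (u - v) * sigma L (u + v)) =
      2 * zeta L u * (sigma L u ^ 2 * sigma L v ^ 2 * (℘[L] v - ℘[L] u)) -
        sigma L u ^ 2 * sigma L v ^ 2 * ℘'[L] u := by
    have h1 := ((hasDerivAt_sigma hm).comp_sub_const u v).mul
      ((hasDerivAt_sigma hp).comp_add_const u v)
    have h2 := (((hasDerivAt_sigma hu).pow 2).mul_const (sigma L v ^ 2)).mul
      ((hasDerivAt_weierstrassP hu).const_sub (℘[L] v))
    have h3 := h1.unique (h2.congr_of_eventuallyEq ?_)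
    · simp at h3
      linear_combination h3
    · filter_upwards [(isOpen_compl_lattice L).mem_nhds hu] with z hz
      simpa using sigma_mul_sigma hz hv
  have Ev : (zeta L (u + v) - zeta L (u - v)) * (sigma L (u - v) * sigma L (u + v)) =
      2 * zeta L v * (sigma L u ^ 2 * sigma L v ^ 2 * (℘[L] v - ℘[L] u)) +
        sigma L u ^ 2 * sigma L v ^ 2 * ℘'[L] v := by
    have h1 := ((hasDerivAt_sigma hm).comp_const_sub u v).mul
      ((hasDerivAt_sigma hp).comp_const_add u v)
    have h2 := (((hasDerivAt_sigma hv).pow 2).const_mul (sigma L u ^ 2)).mul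
      ((hasDerivAt_weierstrassP hv).sub_const (℘[L] u))
    have h3 := h1.unique (h2.congr_of_eventuallyEq ?_)
    · simp at h3
      linear_combination h3
    · filter_upwards [(isOpen_compl_lattice L).mem_nhds hv] with z hz
      simpa using sigma_mul_sigma hu hz
  rw [E] at Eu Ev
  rw [← sub_eq_iff_eq_add', eq_div_iff (mul_ne_zero two_ne_zero hne)]
  apply mul_left_cancel₀ (mul_ne_zero (pow_ne_zero 2 hσu) (pow_ne_zero 2 hσv))
  linear_combination Ev - Eu

lemma mainForm_eq {L : PeriodPair} {u u₀ : ℂ} (c : ℂ) (hu : u ∉ L.lattice) (h0 : u₀ ∉ L.lattice)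
    (h : ℘[L] u ≠ ℘[L] u₀) :
    mainForm L u₀ c u = zeta L (u - u₀) - zeta L u + (zeta L u₀ + c) := by
  rw [mainForm, zeta_sub hu h0 h]
  ring

/-! ### The solution by sigma functions -/

/-- The logarithmic derivative of the sigma quotient is `ζ(u - u₀) - ζ(u) + ζ(u₀) + c`, which is
`mainForm` by the addition formula. -/
lemma hasDerivAt_solution {L : PeriodPair} {u u₀ : ℂ} (c : ℂ) (hu : u ∉ L.lattice)
    (h0 : u₀ ∉ L.lattice) (h : ℘[L] u ≠ ℘[L] u₀) :
    HasDerivAt (solution L u₀ c) (mainForm L u₀ c u * solution L u₀ c u) u := by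
  rw [mainForm_eq c hu h0 h]
  have hσ := sigma_ne_zero hu
  convert! (((hasDerivAt_sigma (sub_notMem_of_weierstrassP_ne h)).comp_sub_const u u₀).div
    (hasDerivAt_sigma hu) hσ).mul ((hasDerivAt_id u).const_mul (zeta L u₀ + c)).cexp using 1
  simp only [solution, id, Pi.div_apply]
  field_simp

lemma solution_add (L : PeriodPair) (u₀ c u : ℂ) (γ : L.lattice) :
    solution L u₀ c (u + γ) =
      exp (-u₀ * quasiPeriod L γ + zeta L u₀ * γ + c * γ) * solution L u₀ c u := by
  -- At lattice points both sides are `0`, since the denominator `σ` vanishes and division by zero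
  -- is zero.
  by_cases hu : u ∈ L.lattice
  · have h1 := sigma_coe L ⟨u, hu⟩
    have h2 := sigma_coe L (⟨u, hu⟩ + γ)
    simp only [Submodule.coe_add] at h1 h2
    simp [solution, h1, h2]
  obtain ⟨C, hC, hσ⟩ := exists_sigma_add L γ
  have hσu := sigma_ne_zero hu
  have e := exp_ne_zero (quasiPeriod L γ * u)
  rw [solution, solution, show u + γ - u₀ = u - u₀ + γ by ring, hσ, hσ,
    show quasiPeriod L γ * (u - u₀) = quasiPeriod L γ * u + -u₀ * quasiPeriod L γ by ring,
    show (zeta L u₀ + c) * (u + γ) = (zeta L u₀ + c) * u + (zeta L u₀ * γ + c * γ) by ring,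
    add_assoc (-u₀ * quasiPeriod L γ), exp_add, exp_add, exp_add (-u₀ * quasiPeriod L γ)]
  field_simp

/-! ### The Legendre relation -/

lemma exists_eq_gen (L : PeriodPair) (γ : L.lattice) :
    ∃ m n : ℤ, γ = m • gen₁ L + n • gen₂ L := by
  refine ⟨(L.latticeEquivProd γ).1, (L.latticeEquivProd γ).2, Subtype.ext ?_⟩
  have := L.latticeEquiv_symm_apply (L.latticeEquivProd γ)
  rw [LinearEquiv.symm_apply_apply] at this
  simpa [gen₁, gen₂] using this

lemma quasiPeriod_gen (L : PeriodPair) (m n : ℤ) :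
    quasiPeriod L (m • gen₁ L + n • gen₂ L) =
      m * quasiPeriod L (gen₁ L) + n * quasiPeriod L (gen₂ L) := by
  have := (quasiPeriodHom L).map_add (m • gen₁ L) (n • gen₂ L)
  rw [map_zsmul, map_zsmul, zsmul_eq_mul, zsmul_eq_mul] at this
  exact this

lemma coe_gen (L : PeriodPair) (m n : ℤ) :
    ((m • gen₁ L + n • gen₂ L : L.lattice) : ℂ) = m * L.ω₁ + n * L.ω₂ := by
  simp [gen₁, gen₂]

lemma ω₁_ne_zero (L : PeriodPair) : L.ω₁ ≠ 0 := by
  intro h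
  apply L.ω₁_div_two_notMem_lattice
  simp [h]

/-- The periods form a real basis of `ℂ`, and every real linear form on `ℂ` is `z ↦ Re(bz)`. This
serves to prescribe the moduli of two multipliers. -/
lemma exists_re_mul_eq (L : PeriodPair) (r₁ r₂ : ℝ) :
    ∃ b : ℂ, (b * L.ω₁).re = r₁ ∧ (b * L.ω₂).re = r₂ := by
  let φ : ℂ →ₗ[ℝ] ℝ := L.basis.constr ℝ ![r₁, r₂]
  have h : ∀ z, ((φ 1 - φ I * I : ℂ) * z).re = φ z := by
    intro z
    have e : z = z.re • (1 : ℂ) + z.im • I := by simp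
    conv_rhs => rw [e, map_add, map_smul, map_smul]
    simp
    ring
  refine ⟨_, (h L.ω₁).trans ?_, (h L.ω₂).trans ?_⟩
  · rw [← L.basis_zero, Module.Basis.constr_basis]; rfl
  · rw [← L.basis_one, Module.Basis.constr_basis]; rfl

/-- The Legendre determinant `η₁ ω₂ - η₂ ω₁`. -/
def legendreDet (L : PeriodPair) : ℂ :=
  quasiPeriod L (gen₁ L) * L.ω₂ - quasiPeriod L (gen₂ L) * L.ω₁

/-- If the determinant vanished, the quasi-periods would be `ζ(γ) = aγ`. Then `σ(z) exp(-az²/2 +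
bz)` would have constant multipliers, of modulus one for a suitable `b`, and Liouville would make it
constant; but it vanishes at `0` and not at `ω₁ / 2`. -/
lemma legendreDet_ne_zero (L : PeriodPair) : legendreDet L ≠ 0 := by
  intro h0
  rw [legendreDet, sub_eq_zero] at h0
  have hω := ω₁_ne_zero L
  obtain ⟨a, ha⟩ : ∃ a, a = quasiPeriod L (gen₁ L) / L.ω₁ := ⟨_, rfl⟩
  have h1 : quasiPeriod L (gen₁ L) = a * L.ω₁ := by rw [ha]; field_simp
  have h2 : quasiPeriod L (gen₂ L) = a * L.ω₂ := by rw [ha]; field_simp; rw [← h0]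
  obtain ⟨C₁, hC₁, hσ₁⟩ := exists_sigma_add L (gen₁ L)
  obtain ⟨C₂, hC₂, hσ₂⟩ := exists_sigma_add L (gen₂ L)
  obtain ⟨b, hb₁, hb₂⟩ := exists_re_mul_eq L (-Real.log ‖C₁ * exp (-a * L.ω₁ ^ 2 / 2)‖)
    (-Real.log ‖C₂ * exp (-a * L.ω₂ ^ 2 / 2)‖)
  set F : ℂ → ℂ := fun z ↦ sigma L z * exp (-a * z ^ 2 / 2 + b * z) with hF
  have step : ∀ C t : ℂ, C ≠ 0 → (∀ z, sigma L (z + t) = C * exp (a * t * z) * sigma L z) →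
      (b * t).re = -Real.log ‖C * exp (-a * t ^ 2 / 2)‖ → ∀ z, ‖F (z + t)‖ = ‖F z‖ := by
    intro C t hC hσ hb z
    have e : F (z + t) = (C * exp (-a * t ^ 2 / 2)) * exp (b * t) * F z := by
      simp only [hF]
      rw [hσ, show -a * (z + t) ^ 2 / 2 + b * (z + t) =
        -(a * t * z) + -a * t ^ 2 / 2 + b * t + (-a * z ^ 2 / 2 + b * z) by ring, exp_add, exp_add,
        exp_add, exp_neg]
      have := exp_ne_zero (a * t * z)
      field_simp
    have hpos : 0 < ‖C * exp (-a * t ^ 2 / 2)‖ :=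
      norm_pos_iff.2 (mul_ne_zero hC (exp_ne_zero _))
    rw [e, norm_mul, norm_mul, norm_exp, hb, Real.exp_neg, Real.exp_log hpos,
      mul_inv_cancel₀ hpos.ne', one_mul]
  -- The periods of `‖F‖` form a group, so the two generators suffice.
  let H : AddSubgroup ℂ :=
    { carrier := {γ | ∀ z, ‖F (z + γ)‖ = ‖F z‖}
      zero_mem' := fun z ↦ by rw [add_zero]
      add_mem' := fun {x y} hx hy z ↦ by rw [← add_assoc, hy, hx]
      neg_mem' := fun {x} hx z ↦ by
        have := hx (z + -x)
        rw [neg_add_cancel_right] at this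
        exact this.symm }
  have hg1 : L.ω₁ ∈ H := step C₁ L.ω₁ hC₁ (fun z ↦ by rw [← h1]; exact hσ₁ z) hb₁
  have hg2 : L.ω₂ ∈ H := step C₂ L.ω₂ hC₂ (fun z ↦ by rw [← h2]; exact hσ₂ z) hb₂
  have hd : Differentiable ℂ F := by
    have := differentiable_sigma L
    fun_prop
  have hconst := eq_const_of_norm_periodic (L := L) hd (fun z γ ↦ ?_) (L.ω₁ / 2) 0
  · simp only [hF, sigma_zero, zero_mul, mul_eq_zero, exp_ne_zero, or_false] at hconst
    exact sigma_ne_zero L.ω₁_div_two_notMem_lattice hconst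
  · obtain ⟨m, n, rfl⟩ := exists_eq_gen L γ
    have : ((m • gen₁ L + n • gen₂ L : L.lattice) : ℂ) ∈ H :=
      H.add_mem (H.zsmul_mem hg1 m) (H.zsmul_mem hg2 n)
    exact this z

/-- An elliptic function whose only poles are simple poles at lattice points has no pole. -/
lemma eq_zero_of_simple_pole {L : PeriodPair} {f N : ℂ → ℂ}
    (hd : ∀ z ∉ L.lattice, DifferentiableAt ℂ f z)
    (hper : ∀ z, ∀ γ : L.lattice, f (z + γ) = f z)
    (hN : AnalyticAt ℂ N 0) (hfN : ∀ᶠ z in 𝓝[≠] 0, f z = N z / z) : N 0 = 0 := by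
  by_contra hr
  set r := N 0 with hr_def
  have hN1 : AnalyticAt ℂ (dslope N 0) 0 := by
    obtain ⟨p, hp⟩ := hN
    exact ⟨_, hp.has_fpower_series_dslope_fslope⟩
  have hder : ∀ z ∉ L.lattice, HasDerivAt f (deriv f z) z := fun z hz ↦ (hd z hz).hasDerivAt
  have hf1 : ∀ᶠ z in 𝓝[≠] 0, f z = r / z + dslope N 0 z := by
    filter_upwards [hfN, self_mem_nhdsWithin] with z h1 h2
    have h2 : z ≠ 0 := h2
    rw [h1, dslope_of_ne _ h2, slope_def_field]
    field_simp
    ring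
  have hP := L.analyticAt_weierstrassPExcept 0
  -- The elliptic function `f' + r℘` has no pole, so it is a constant `a` and `f - rζ - az` is
  -- constant. Periodicity of `f` forces `rζ(γ) = -aγ`, which the nonvanishing Legendre determinant
  -- excludes for `r ≠ 0`.
  have key := eq_const_of_periodic (L := L) (f := fun z ↦ deriv f z + r * ℘[L] z)
    (g := fun z ↦ deriv (dslope N 0) z + r * L.weierstrassPExcept 0 z) ?_ ?_
    (hN1.deriv.add (analyticAt_const.mul hP)) ?_
  · set a := deriv (dslope N 0) 0 + r * L.weierstrassPExcept 0 0
    have hconst : ∀ z ∉ L.lattice, HasDerivAt (fun z ↦ f z + -r * zeta L z - a * z) 0 z := by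
      intro z hz
      convert! ((hder z hz).add ((hasDerivAt_zeta L hz).const_mul (-r))).sub
        ((hasDerivAt_id z).const_mul a) using 1
      linear_combination -(key z hz)
    have h2 : ∀ γ : L.lattice, r * quasiPeriod L γ = -a * γ := by
      intro γ
      have h0 := L.ω₁_div_two_notMem_lattice
      have := eqOn_const_of_hasDerivAt_zero hconst (add_notMem h0 γ) h0
      simp only [hper, zeta_add L h0] at this
      linear_combination -this
    apply legendreDet_ne_zero L
    apply mul_left_cancel₀ hr
    have e1 := h2 (gen₁ L)
    have e2 := h2 (gen₂ L)
    simp only [gen₁, gen₂] at e1 e2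
    simp only [legendreDet, gen₁, gen₂]
    linear_combination L.ω₂ * e1 - L.ω₁ * e2
  · intro z hz
    have h1 : DifferentiableAt ℂ ℘[L] z := (L.analyticOnNhd_weierstrassP z hz).differentiableAt
    have hdo : DifferentiableOn ℂ f (L.lattice : Set ℂ)ᶜ :=
      fun w hw ↦ (hd w hw).differentiableWithinAt
    have h2 : AnalyticAt ℂ f z := hdo.analyticAt ((isOpen_compl_lattice L).mem_nhds hz)
    have h3 := h2.deriv.differentiableAt
    fun_prop
  · intro z hz γ
    rw [L.weierstrassP_add_coe, ← deriv_comp_add_const]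
    simp_rw [hper]
  · have h1 : ∀ᶠ z in 𝓝[≠] 0, f =ᶠ[𝓝 z] fun z ↦ r / z + dslope N 0 z := by
      have := eventually_eventually_nhdsWithin.2 hf1
      filter_upwards [this, self_mem_nhdsWithin] with z hz hz0
      rwa [IsOpen.nhdsWithin_eq isOpen_compl_singleton hz0] at hz
    have h2 : ∀ᶠ z in 𝓝[≠] (0 : ℂ), DifferentiableAt ℂ (dslope N 0) z :=
      (hN1.eventually_analyticAt.mono fun z hz ↦ hz.differentiableAt).filter_mono
        nhdsWithin_le_nhds
    filter_upwards [h1, h2, self_mem_nhdsWithin] with z hz1 hz2 hz0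
    have hz0 : z ≠ 0 := hz0
    have h0 := L.weierstrassPExcept_def 0 z
    simp only [ZeroMemClass.coe_zero, ne_eq, OfNat.ofNat_ne_zero, not_false_eq_true, zero_pow,
      div_zero, sub_zero] at h0
    have h3 : HasDerivAt (fun z ↦ r / z + dslope N 0 z) (-r / z ^ 2 + deriv (dslope N 0) z) z := by
      convert! ((hasDerivAt_inv hz0).const_mul r).add hz2.hasDerivAt using 1
      ring
    rw [hz1.deriv_eq, h3.deriv, h0]
    ring

/-- The zero of `σ` at `0` is simple, so the sigma quotient has at most a simple pole there, with
residue nonzero as soon as `u₀ ∉ Λ`. -/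
lemma analyticAt_solution_mul (L : PeriodPair) (u₀ c : ℂ) :
    ∃ N : ℂ → ℂ, AnalyticAt ℂ N 0 ∧ N 0 = -sigma L u₀ ∧
      ∀ᶠ z in 𝓝[≠] 0, solution L u₀ c z = N z / z := by
  refine ⟨fun z ↦ sigma L (z - u₀) / sigmaQuot L z * exp ((zeta L u₀ + c) * z), ?_, ?_, ?_⟩
  · have h := differentiable_sigma L
    refine .mul (.div (Differentiable.analyticAt (by fun_prop) 0) (analyticAt_sigmaQuot L 0)
      (by simp [sigmaQuot_zero])) (Differentiable.analyticAt (by fun_prop) 0)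
  · simp [sigmaQuot_zero, sigma_neg]
  · filter_upwards [eventually_notMem_lattice L 0] with z hz
    have h0 := ne_zero_of_notMem hz
    have h1 := sigmaQuot_ne_zero hz
    rw [solution, sigma_eq L z]
    field_simp

/-- The Legendre relation, up to sign. -/
lemma legendreDet_eq (L : PeriodPair) :
    ∃ ε : ℤ, (ε = 1 ∨ ε = -1) ∧ legendreDet L = 2 * Real.pi * I * ε := by
  obtain ⟨k, hk⟩ := exp_eq_one_iff.1 (exp_legendre L (gen₁ L) (gen₂ L))
  have hk' : legendreDet L = k * (2 * Real.pi * I) := hk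
  have hk0 : (k : ℂ) ≠ 0 := by
    intro h
    apply legendreDet_ne_zero L
    rw [hk', h, zero_mul]
  refine ⟨k, ?_, by rw [hk']; ring⟩
  -- The determinant is `2πik`. Were `ω₁ / k` outside `Λ`, the sigma quotient with `u₀ = ω₁ / k` and
  -- exponent `(η₁ / k)u` would have multipliers `1` along `ω₁` and `exp(2πi) = 1` along `ω₂`: an
  -- elliptic function with a single simple pole modulo `Λ`. So `1 / k` is an integer.
  have hx : L.ω₁ / k ∈ L.lattice := by
    by_contra hx
    obtain ⟨N, hN, hN0, hsN⟩ := analyticAt_solution_mul L (L.ω₁ / k)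
      (quasiPeriod L (gen₁ L) / k - zeta L (L.ω₁ / k))
    refine neg_ne_zero.2 (sigma_ne_zero hx) (hN0 ▸ eq_zero_of_simple_pole (L := L) ?_ ?_ hN hsN)
    · intro z hz
      have h := differentiable_sigma L
      refine .mul (.div (by fun_prop) (by fun_prop) (sigma_ne_zero hz)) (by fun_prop)
    · intro z γ
      obtain ⟨m, n, rfl⟩ := exists_eq_gen L γ
      rw [solution_add, quasiPeriod_gen, coe_gen]
      have : -(L.ω₁ / k) * (m * quasiPeriod L (gen₁ L) + n * quasiPeriod L (gen₂ L)) +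
          zeta L (L.ω₁ / k) * (m * L.ω₁ + n * L.ω₂) +
          (quasiPeriod L (gen₁ L) / k - zeta L (L.ω₁ / k)) * (m * L.ω₁ + n * L.ω₂) =
          n * (2 * Real.pi * I) := by
        rw [legendreDet] at hk'
        field_simp
        linear_combination n * hk'
      rw [this, exp_int_mul_two_pi_mul_I, one_mul]
  have h := (L.mul_ω₁_add_mul_ω₂_mem_lattice (α := 1 / k) (β := 0)).1 (by
    push_cast
    convert! hx using 1
    ring)
  have hq : ((1 / k : ℚ).num : ℚ) = 1 / k := Rat.den_eq_one_iff _ |>.1 h.1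
  have hkq : (k : ℚ) ≠ 0 := by exact_mod_cast hk0
  have hu : (1 / k : ℚ).num * k = 1 := by
    have : ((1 / k : ℚ).num : ℚ) * k = 1 := by rw [hq]; field_simp
    exact_mod_cast this
  exact Int.isUnit_iff.1 (IsUnit.of_mul_eq_one_right _ hu)

/-! ### The universal cover of `A₀` and the characters of the lattice -/

lemma proj_add (L : PeriodPair) (u : ℂ) (γ : L.lattice) : proj L (u + γ) = proj L u :=
  QuotientAddGroup.eq.2 (by simp)

lemma exists_of_proj_eq {L : PeriodPair} {u v : ℂ} (h : proj L u = proj L v) :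
    ∃ γ : L.lattice, v = u + γ := by
  have : -u + v ∈ L.lattice := QuotientAddGroup.eq.1 h
  exact ⟨⟨-u + v, this⟩, by simp⟩

open Classical in
/-- The zeta function, completed by the quasi-periods at the lattice points. -/
def zetaHat (L : PeriodPair) (x : ℂ) : ℂ :=
  if h : x ∈ L.lattice then quasiPeriod L ⟨x, h⟩ else zeta L x

lemma zetaHat_coe (L : PeriodPair) (γ : L.lattice) : zetaHat L γ = quasiPeriod L γ :=
  dif_pos γ.2

lemma zetaHat_of_notMem {L : PeriodPair} {x : ℂ} (hx : x ∉ L.lattice) :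
    zetaHat L x = zeta L x := dif_neg hx

lemma zetaHat_zero (L : PeriodPair) : zetaHat L 0 = 0 :=
  (zetaHat_coe L 0).trans (quasiPeriod_zero L)

lemma zetaHat_add (L : PeriodPair) (x : ℂ) (γ : L.lattice) :
    zetaHat L (x + γ) = zetaHat L x + quasiPeriod L γ := by
  by_cases hx : x ∈ L.lattice
  · have h1 := zetaHat_coe L (⟨x, hx⟩ + γ)
    have h2 := zetaHat_coe L ⟨x, hx⟩
    simp only [Submodule.coe_add] at h1
    simp only at h2
    rw [h1, h2, quasiPeriod_add]
  · rw [zetaHat_of_notMem hx, zetaHat_of_notMem (add_notMem hx γ), zeta_add L hx]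

/-- The character `γ ↦ exp (w γ - x ζ(γ))` of the lattice. -/
def chi (L : PeriodPair) (x w : ℂ) : Multiplicative L.lattice →* ℂˣ :=
  MonoidHom.mk' (fun γ ↦ Units.mk0 (exp (w * γ.toAdd - x * quasiPeriod L γ.toAdd)) (exp_ne_zero _))
    fun γ δ ↦ by
      ext
      simp only [toAdd_mul, quasiPeriod_add, Submodule.coe_add, Units.val_mk0, Units.val_mul,
        ← exp_add]
      ring_nf

lemma chi_apply (L : PeriodPair) (x w : ℂ) (γ : L.lattice) :
    (chi L x w (.ofAdd γ) : ℂ) = exp (w * γ - x * quasiPeriod L γ) := rfl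

/-- This is the Legendre relation modulo `2πi`: the pair `(γ, ζ(γ))` has trivial character. -/
lemma chi_add (L : PeriodPair) (x w : ℂ) (γ : L.lattice) :
    chi L (x + γ) (w + quasiPeriod L γ) = chi L x w := by
  refine MonoidHom.ext fun δ ↦ Units.ext ?_
  obtain ⟨δ, rfl⟩ := Multiplicative.ofAdd.surjective δ
  rw [chi_apply, chi_apply, show (w + quasiPeriod L γ) * (δ : ℂ) - (x + γ) * quasiPeriod L δ =
    (w * (δ : ℂ) - x * quasiPeriod L δ) + (quasiPeriod L γ * δ - quasiPeriod L δ * γ) by ring,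
    exp_add, exp_legendre, mul_one]

lemma hom_ext_gen {L : PeriodPair} {ρ ρ' : Multiplicative L.lattice →* ℂˣ}
    (h₁ : ρ (.ofAdd (gen₁ L)) = ρ' (.ofAdd (gen₁ L)))
    (h₂ : ρ (.ofAdd (gen₂ L)) = ρ' (.ofAdd (gen₂ L))) : ρ = ρ' := by
  refine MonoidHom.ext fun γ ↦ ?_
  obtain ⟨m, n, h⟩ := exists_eq_gen L γ.toAdd
  have : γ = .ofAdd (gen₁ L) ^ m * .ofAdd (gen₂ L) ^ n := by
    rw [← ofAdd_zsmul, ← ofAdd_zsmul, ← ofAdd_add, ← h, ofAdd_toAdd]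
  rw [this, map_mul, map_mul, map_zpow, map_zpow, map_zpow, map_zpow, h₁, h₂]

/-- Equality on the generators is a linear system whose right side consists of integer multiples of
`2πi`. Its determinant being exactly `±2πi`, Cramer's rule gives integer coefficients; a larger
multiple would not do. -/
lemma exists_of_chi_eq {L : PeriodPair} {x w x' w' : ℂ} (h : chi L x w = chi L x' w') :
    ∃ γ : L.lattice, x' = x + γ ∧ w' = w + quasiPeriod L γ := by
  obtain ⟨ε, hε, hdet⟩ := legendreDet_eq L
  have hε2 : (ε : ℂ) * ε = 1 := by
    rcases hε with rfl | rfl <;> simp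
  have h1 : (chi L x w (.ofAdd (gen₁ L)) : ℂ) = chi L x' w' (.ofAdd (gen₁ L)) := by rw [h]
  have h2 : (chi L x w (.ofAdd (gen₂ L)) : ℂ) = chi L x' w' (.ofAdd (gen₂ L)) := by rw [h]
  rw [chi_apply, chi_apply, exp_eq_exp_iff_exists_int] at h1 h2
  obtain ⟨m, hm⟩ := h1
  obtain ⟨n, hn⟩ := h2
  have hD := legendreDet_ne_zero L
  have hpi : (2 * Real.pi * I : ℂ) = ε * legendreDet L := by
    rw [hdet]
    linear_combination -(2 * Real.pi * I : ℂ) * hε2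
  rw [hpi] at hm hn
  refine ⟨(ε * m) • gen₂ L + (-ε * n) • gen₁ L, ?_, ?_⟩
  · rw [add_comm (_ • gen₂ L), coe_gen]
    apply mul_right_cancel₀ hD
    simp only [gen₁, gen₂, legendreDet] at hm hn ⊢
    push_cast
    linear_combination L.ω₂ * hm - L.ω₁ * hn
  · rw [add_comm (_ • gen₂ L), quasiPeriod_gen]
    apply mul_right_cancel₀ hD
    simp only [gen₁, gen₂, legendreDet] at hm hn ⊢
    push_cast
    linear_combination quasiPeriod L ⟨L.ω₂, L.ω₂_mem_lattice⟩ * hm -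
      quasiPeriod L ⟨L.ω₁, L.ω₁_mem_lattice⟩ * hn

/-- The solution `(x, w)` of `w ω₁ - x η₁ = a`, `w ω₂ - x η₂ = b`. -/
def periodSolve (L : PeriodPair) (a b : ℂ) : ℂ × ℂ :=
  ((L.ω₁ * b - L.ω₂ * a) / legendreDet L,
    (quasiPeriod L (gen₁ L) * b - quasiPeriod L (gen₂ L) * a) / legendreDet L)

lemma periodSolve_spec (L : PeriodPair) (a b : ℂ) :
    (periodSolve L a b).2 * L.ω₁ - (periodSolve L a b).1 * quasiPeriod L (gen₁ L) = a ∧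
    (periodSolve L a b).2 * L.ω₂ - (periodSolve L a b).1 * quasiPeriod L (gen₂ L) = b := by
  have hD := legendreDet_ne_zero L
  constructor
  all_goals
    simp only [periodSolve]
    field_simp
    rw [legendreDet]
    ring

lemma chi_periodSolve (L : PeriodPair) (a b : ℂ) :
    (chi L (periodSolve L a b).1 (periodSolve L a b).2 (.ofAdd (gen₁ L)) : ℂ) = exp a ∧
    (chi L (periodSolve L a b).1 (periodSolve L a b).2 (.ofAdd (gen₂ L)) : ℂ) = exp b := by
  have h := periodSolve_spec L a b
  rw [chi_apply, chi_apply]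
  exact ⟨congrArg exp h.1, congrArg exp h.2⟩

lemma exists_chi_eq {L : PeriodPair} (ρ : Multiplicative L.lattice →* ℂˣ) :
    ∃ x w, chi L x w = ρ := by
  have h := chi_periodSolve L (log (ρ (.ofAdd (gen₁ L)))) (log (ρ (.ofAdd (gen₂ L))))
  rw [exp_log (Units.ne_zero _), exp_log (Units.ne_zero _)] at h
  exact ⟨_, _, hom_ext_gen (Units.ext h.1) (Units.ext h.2)⟩

/-- The covering map `ℂ² → A₀`. -/
def point (L : PeriodPair) (x w : ℂ) : A₀ L := ⟨proj L x, (w - zetaHat L x : ℂ)⟩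

lemma A₀_ext {L : PeriodPair} {b b' : Curve L} {v v' : ℂ} (hb : b = b') (hv : v = v') :
    (⟨b, v⟩ : A₀ L) = ⟨b', v'⟩ := by
  subst hb hv
  rfl

lemma A₀_ext_iff {L : PeriodPair} {b b' : Curve L} {v v' : ℂ} :
    (⟨b, v⟩ : A₀ L) = ⟨b', v'⟩ ↔ b = b' ∧ v = v' := by
  refine ⟨fun h ↦ ?_, fun h ↦ A₀_ext h.1 h.2⟩
  have h2 := congrArg (fun p : A₀ L ↦ (p.2 : ℂ)) h
  exact ⟨congrArg (fun p : A₀ L ↦ p.proj) h, h2⟩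

/-- As `zetaHat` grows by `ζ(γ)` along `γ`, the coordinate `w - zetaHat x` is invariant exactly
under simultaneous shifts of `x` and `w`: `A₀` is the quotient of `ℂ²` by the pairs `(γ, ζ(γ))`. -/
lemma point_eq_iff {L : PeriodPair} {x w x' w' : ℂ} : point L x w = point L x' w' ↔
    ∃ γ : L.lattice, x' = x + γ ∧ w' = w + quasiPeriod L γ := by
  rw [point, point, A₀_ext_iff]
  constructor
  · rintro ⟨h1, h2⟩
    obtain ⟨γ, rfl⟩ := exists_of_proj_eq h1
    rw [zetaHat_add] at h2
    exact ⟨γ, rfl, by linear_combination -h2⟩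
  · rintro ⟨γ, rfl, rfl⟩
    rw [zetaHat_add, proj_add]
    exact ⟨rfl, by ring⟩

lemma exists_point_eq {L : PeriodPair} (p : A₀ L) : ∃ x w, point L x w = p := by
  obtain ⟨b, v⟩ := p
  obtain ⟨x, hx⟩ := proj_surjective L b
  refine ⟨x, (show ℂ from v) + zetaHat L x, A₀_ext hx (add_sub_cancel_right _ _)⟩

lemma point_eq_iff_chi {L : PeriodPair} {x w x' w' : ℂ} :
    point L x w = point L x' w' ↔ chi L x w = chi L x' w' := by
  rw [point_eq_iff]
  refine ⟨?_, exists_of_chi_eq⟩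
  rintro ⟨γ, rfl, rfl⟩
  rw [chi_add]

lemma mainPoint_eq {L : PeriodPair} {u₀ : ℂ} (h : u₀ ∉ L.lattice) (c : ℂ) :
    mainPoint L u₀ c = point L u₀ (c + zeta L u₀) :=
  A₀_ext rfl (by rw [zetaHat_of_notMem h, add_sub_cancel_right])

lemma zeroPoint_eq (L : PeriodPair) (c₀ : ℂ) : zeroPoint L c₀ = point L 0 c₀ :=
  A₀_ext rfl (by rw [zetaHat_zero, sub_zero])

/-- The character of the lattice attached to a point of `A₀`. -/
def character (L : PeriodPair) (p : A₀ L) : Multiplicative L.lattice →* ℂˣ :=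
  chi L (exists_point_eq p).choose (exists_point_eq p).choose_spec.choose

lemma character_point (L : PeriodPair) (x w : ℂ) : character L (point L x w) = chi L x w :=
  point_eq_iff_chi.1 (exists_point_eq (point L x w)).choose_spec.choose_spec

lemma character_injective (L : PeriodPair) : Function.Injective (character L) := by
  intro p q h
  obtain ⟨x, w, rfl⟩ := exists_point_eq p
  obtain ⟨x', w', rfl⟩ := exists_point_eq q
  rw [character_point, character_point] at h
  exact point_eq_iff_chi.2 h

lemma character_surjective (L : PeriodPair) : Function.Surjective (character L) := by
  intro ρ
  obtain ⟨x, w, h⟩ := exists_chi_eq ρ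
  exact ⟨point L x w, (character_point L x w).trans h⟩

/-- The Riemann–Hilbert mapping. -/
def rhMap (L : PeriodPair) (p : A₀ L) : ℂˣ × ℂˣ :=
  (character L p (.ofAdd (gen₁ L)), character L p (.ofAdd (gen₂ L)))

lemma rhMap_eq_iff {L : PeriodPair} {p : A₀ L} {ρ : Multiplicative L.lattice →* ℂˣ} :
    rhMap L p = (ρ (.ofAdd (gen₁ L)), ρ (.ofAdd (gen₂ L))) ↔ character L p = ρ := by
  constructor
  · intro h
    exact hom_ext_gen (Prod.ext_iff.1 h).1 (Prod.ext_iff.1 h).2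
  · rintro rfl
    rfl

lemma rhMap_injective (L : PeriodPair) : Function.Injective (rhMap L) := fun _ _ h ↦
  character_injective L (rhMap_eq_iff.1 h)

lemma rhMap_point_periodSolve (L : PeriodPair) (a b : ℂ) (A B : ℂˣ) (ha : exp a = A)
    (hb : exp b = B) : rhMap L (point L (periodSolve L a b).1 (periodSolve L a b).2) = (A, B) := by
  rw [rhMap, character_point]
  exact Prod.ext (Units.ext ((chi_periodSolve L a b).1.trans ha))
    (Units.ext ((chi_periodSolve L a b).2.trans hb))

lemma rhMap_surjective (L : PeriodPair) : Function.Surjective (rhMap L) := fun ⟨A, B⟩ ↦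
  ⟨_, rhMap_point_periodSolve L (log A) (log B) A B (exp_log A.ne_zero) (exp_log B.ne_zero)⟩

/-! ### Horizontal frames -/

lemma continuous_proj (L : PeriodPair) : Continuous (proj L) :=
  (isLocalHomeomorph_proj L).continuous

variable {L : PeriodPair}

lemma isOpen_preimage_U (E : LineBundle L) (i : E.ι) : IsOpen (proj L ⁻¹' E.U i) :=
  (E.isOpen_U i).preimage (continuous_proj L)

/-- A horizontal frame of the pullback of `E` to an open subset `W` of the universal cover. -/
structure Connection.IsFrameOn (E : Connection L) (s : E.ι → ℂ → ℂ) (W : Set ℂ) : Prop where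
  ne_zero : ∀ i, ∀ u ∈ W, proj L u ∈ E.U i → s i u ≠ 0
  glue : ∀ i j, ∀ u ∈ W, proj L u ∈ E.U i → proj L u ∈ E.U j →
    s i u = E.g i j (proj L u) * s j u
  horizontal : ∀ i, ∀ u ∈ W, proj L u ∈ E.U i →
    HasDerivAt (s i) (E.a i (proj L u) * s i u) u

namespace Connection

variable {E : Connection L} {s s' : E.ι → ℂ → ℂ} {W W' : Set ℂ}

lemma IsFrameOn.mono (h : E.IsFrameOn s W) (hW : W' ⊆ W) : E.IsFrameOn s W' where
  ne_zero i u hu := h.ne_zero i u (hW hu)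
  glue i j u hu := h.glue i j u (hW hu)
  horizontal i u hu := h.horizontal i u (hW hu)

lemma isFrameOn_univ_iff : E.IsFrameOn s Set.univ ↔ E.IsHorizontalFrame s :=
  ⟨fun h ↦ ⟨fun i u hu ↦ h.ne_zero i u trivial hu,
    fun i j u hu ↦ h.glue i j u trivial hu.1 hu.2, fun i u hu ↦ h.horizontal i u trivial hu⟩,
   fun h ↦ ⟨fun i u _ hu ↦ h.ne_zero i u hu, fun i j u _ hi hj ↦ h.glue i j u ⟨hi, hj⟩,
    fun i u _ hu ↦ h.horizontal i u hu⟩⟩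

lemma IsFrameOn.const_mul (h : E.IsFrameOn s W) {K : ℂ} (hK : K ≠ 0) :
    E.IsFrameOn (fun i u ↦ K * s i u) W where
  ne_zero i u hu hi := mul_ne_zero hK (h.ne_zero i u hu hi)
  glue i j u hu hi hj := by rw [h.glue i j u hu hi hj]; ring
  horizontal i u hu hi := by
    convert! (h.horizontal i u hu hi).const_mul K using 1
    ring

/-- Being a horizontal frame is a local property. -/
lemma isFrameOn_of_local (h : ∀ u ∈ W, ∃ s' V, IsOpen V ∧ u ∈ V ∧ E.IsFrameOn s' V ∧
    ∀ i, ∀ v ∈ V, proj L v ∈ E.U i → s i v = s' i v) : E.IsFrameOn s W where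
  ne_zero i u hu hi := by
    obtain ⟨s', V, -, huV, hs', e⟩ := h u hu
    rw [e i u huV hi]
    exact hs'.ne_zero i u huV hi
  glue i j u hu hi hj := by
    obtain ⟨s', V, -, huV, hs', e⟩ := h u hu
    rw [e i u huV hi, e j u huV hj]
    exact hs'.glue i j u huV hi hj
  horizontal i u hu hi := by
    obtain ⟨s', V, hV, huV, hs', e⟩ := h u hu
    rw [e i u huV hi]
    refine (hs'.horizontal i u huV hi).congr_of_eventuallyEq ?_
    filter_upwards [hV.mem_nhds huV, (isOpen_preimage_U E.toLineBundle i).mem_nhds hi]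
      with v hv hvi using e i v hv hvi

/-- Horizontal frames over a connected open set agree up to a constant. -/
lemma IsFrameOn.exists_eq_const_mul (hs : E.IsFrameOn s W) (hs' : E.IsFrameOn s' W)
    (hW : IsOpen W) (hWc : IsPreconnected W) :
    ∃ K : ℂ, K ≠ 0 ∧ ∀ i, ∀ u ∈ W, proj L u ∈ E.U i → s' i u = K * s i u := by
  rcases W.eq_empty_or_nonempty with rfl | ⟨u₀, hu₀⟩
  · exact ⟨1, one_ne_zero, fun i u hu ↦ hu.elim⟩
  choose idx hidx using E.cover
  -- Both frames change index through the same transition function, so their ratio does not depend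
  -- on the chosen index and is a function on all of `W`.
  set q : ℂ → ℂ := fun u ↦ s' (idx (proj L u)) u / s (idx (proj L u)) u with hq
  have hqi : ∀ i, ∀ u ∈ W, proj L u ∈ E.U i → q u = s' i u / s i u := by
    intro i u hu hi
    have hj := hidx (proj L u)
    have hg := E.g_ne_zero (idx (proj L u)) i (proj L u) ⟨hj, hi⟩
    simp only [hq]
    rw [hs'.glue _ i u hu hj hi, hs.glue _ i u hu hj hi, mul_div_mul_left _ _ hg]
  have hder : ∀ u ∈ W, HasDerivAt q 0 u := by
    intro u hu
    have hi := hidx (proj L u)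
    set i := idx (proj L u)
    have hne := hs.ne_zero i u hu hi
    have h1 : HasDerivAt (fun u ↦ s' i u / s i u) 0 u := by
      convert! (hs'.horizontal i u hu hi).div (hs.horizontal i u hu hi) hne using 1
      ring
    refine h1.congr_of_eventuallyEq ?_
    filter_upwards [hW.mem_nhds hu, (isOpen_preimage_U E.toLineBundle i).mem_nhds hi] with v hv hvi
      using hqi i v hv hvi
  refine ⟨q u₀, div_ne_zero (hs'.ne_zero _ _ hu₀ (hidx _)) (hs.ne_zero _ _ hu₀ (hidx _)),
    fun i u hu hi ↦ ?_⟩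
  rw [hW.is_const_of_deriv_eq_zero hWc
    (fun u hu ↦ (hder u hu).differentiableAt.differentiableWithinAt) (fun u hu ↦ (hder u hu).deriv)
    hu₀ hu, hqi i u hu hi, div_mul_cancel₀ _ (hs.ne_zero i u hu hi)]

/-- Inside one trivializing set, the exponential of a primitive of the connection form is
horizontal; the transition functions carry it to the other indices. -/
lemma exists_isFrameOn_ball (E : Connection L) (u : ℂ) :
    ∃ r > 0, ∃ s, E.IsFrameOn s (Metric.ball u r) := by
  obtain ⟨i₀, hi₀⟩ := E.cover (proj L u)
  obtain ⟨r, hr, hball⟩ := Metric.isOpen_iff.1 (isOpen_preimage_U E.toLineBundle i₀) u hi₀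
  obtain ⟨A, hA⟩ := DifferentiableOn.isExactOn_ball (DifferentiableOn.mono (E.holomorphic_a i₀) hball)
  refine ⟨r, hr, fun j v ↦ E.g j i₀ (proj L v) * exp (A v), ?_, ?_, ?_⟩
  · intro i v hv hi
    exact mul_ne_zero (E.g_ne_zero _ _ _ ⟨hi, hball hv⟩) (exp_ne_zero _)
  · intro i j v hv hi hj
    rw [← mul_assoc, E.cocycle _ _ _ _ ⟨⟨hi, hj⟩, hball hv⟩]
  · intro i v hv hi
    have h1 := ((E.holomorphic_g i i₀).differentiableAt ((E.isOpen_U _).inter (E.isOpen_U _))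
      ⟨hi, hball hv⟩).hasDerivAt
    rw [E.compatible i i₀ v ⟨hi, hball hv⟩] at h1
    convert! h1.mul (hA v hv).cexp using 1
    ring

/-- On the connected overlap the two frames are proportional, so rescaling one of them glues them.
-/
lemma IsFrameOn.exists_union (hs : E.IsFrameOn s W) (hs' : E.IsFrameOn s' W') (hW : IsOpen W)
    (hW' : IsOpen W') (hc : IsPreconnected (W ∩ W')) : ∃ t, E.IsFrameOn t (W ∪ W') := by
  classical
  obtain ⟨K, hK, h⟩ := (hs'.mono Set.inter_subset_right).exists_eq_const_mul
    (hs.mono Set.inter_subset_left) (hW.inter hW') hc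
  refine ⟨fun i u ↦ if u ∈ W then s i u else K * s' i u, isFrameOn_of_local fun u hu ↦ ?_⟩
  rcases hu with hu | hu
  · exact ⟨s, W, hW, hu, hs, fun i v hv _ ↦ if_pos hv⟩
  · refine ⟨_, W', hW', hu, hs'.const_mul hK, fun i v hv hi ↦ ?_⟩
    split_ifs with hvW
    · exact h i v ⟨hvW, hv⟩ hi
    · rfl

/-- Continuation along the segment from `0` to `u`: the times reached form a nonempty open and
closed set. Convex domains are kept because their intersections are connected. -/
lemma exists_isFrameOn_convex (E : Connection L) (u : ℂ) :
    ∃ W s, Convex ℝ W ∧ IsOpen W ∧ 0 ∈ W ∧ u ∈ W ∧ E.IsFrameOn s W := by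
  set T : Set ℝ := {t | ∃ W s, Convex ℝ W ∧ IsOpen W ∧ 0 ∈ W ∧ t • u ∈ W ∧ E.IsFrameOn s W}
    with hT
  have hopen : IsOpen T := by
    rw [isOpen_iff_mem_nhds]
    rintro t ⟨W, s, hc, ho, h0, ht, hs⟩
    have hcont : Continuous fun t : ℝ ↦ t • u := by fun_prop
    filter_upwards [(ho.preimage hcont).mem_nhds ht] with t' ht'
    exact ⟨W, s, hc, ho, h0, ht', hs⟩
  have hclosed : IsClosed T := by
    refine isClosed_of_closure_subset fun t ht ↦ ?_
    obtain ⟨r, hr, s', hs'⟩ := E.exists_isFrameOn_ball (t • u)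
    obtain ⟨t₁, ⟨W, s, hc, ho, h0, ht₁, hs⟩, hdist⟩ :=
      Metric.mem_closure_iff.1 ht (r / (‖u‖ + 1)) (by positivity)
    have hball : t₁ • u ∈ Metric.ball (t • u) r := by
      rw [mem_ball_iff_norm, ← sub_smul, norm_smul]
      rw [dist_comm, Real.dist_eq, lt_div_iff₀ (by positivity)] at hdist
      refine lt_of_le_of_lt ?_ hdist
      rw [Real.norm_eq_abs]
      gcongr
      linarith
    obtain ⟨s'', hs''⟩ := hs.exists_union hs' ho Metric.isOpen_ball
      (hc.inter (convex_ball _ _)).isPreconnected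
    let ℓ : ℝ →ₗ[ℝ] ℂ := LinearMap.toSpanSingleton ℝ ℂ u
    have hsub : ℓ '' Set.uIcc 0 t ⊆ W ∪ Metric.ball (t • u) r := by
      rintro _ ⟨x, hx, rfl⟩
      rcases Set.uIcc_subset_uIcc_union_uIcc (b := t₁) hx with hx | hx
      · left
        exact (hc.linear_preimage ℓ).ordConnected.uIcc_subset (by simpa using h0) (by simpa [ℓ] using ht₁) hx
      · right
        exact ((convex_ball (t • u) r).linear_preimage ℓ).ordConnected.uIcc_subset
          (by simpa [ℓ] using hball) (by simpa [ℓ] using hr) hx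
    have hcomp : IsCompact (ℓ '' Set.uIcc 0 t) :=
      isCompact_uIcc.image ℓ.continuous_of_finiteDimensional
    -- The union of `W` and the ball need not be convex; a thin neighbourhood of the segment inside
    -- it is.
    obtain ⟨δ, hδ, hsubδ⟩ := hcomp.exists_thickening_subset_open (ho.union Metric.isOpen_ball) hsub
    refine ⟨Metric.thickening δ (ℓ '' Set.uIcc 0 t), s'',
      ((convex_uIcc 0 t).linear_image ℓ).thickening δ, Metric.isOpen_thickening,
      Metric.self_subset_thickening hδ _ ⟨0, Set.left_mem_uIcc, by simp⟩,
      Metric.self_subset_thickening hδ _ ⟨t, Set.right_mem_uIcc, by simp [ℓ]⟩, hs''.mono hsubδ⟩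
  have h0 : (0 : ℝ) ∈ T := by
    obtain ⟨r, hr, s, hs⟩ := E.exists_isFrameOn_ball 0
    exact ⟨_, s, convex_ball 0 r, Metric.isOpen_ball, Metric.mem_ball_self hr,
      by simpa using hr, hs⟩
  have h1 : (1 : ℝ) ∈ T := by
    rw [IsClopen.eq_univ ⟨hclosed, hopen⟩ ⟨0, h0⟩]
    trivial
  simpa [hT] using h1

/-- Every connection has a horizontal frame on the universal cover. -/
lemma exists_isHorizontalFrame (E : Connection L) : ∃ s, E.IsHorizontalFrame s := by
  obtain ⟨i₀, hi₀⟩ := E.cover (proj L 0)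
  -- The normalization at `0`, common to all these domains, makes the local frames agree on
  -- overlaps.
  have hex : ∀ u : ℂ, ∃ W s, Convex ℝ W ∧ IsOpen W ∧ 0 ∈ W ∧ u ∈ W ∧ E.IsFrameOn s W ∧
      s i₀ 0 = 1 := by
    intro u
    obtain ⟨W, s, hc, ho, h0, hu, hs⟩ := E.exists_isFrameOn_convex u
    have hne := hs.ne_zero i₀ 0 h0 hi₀
    exact ⟨W, _, hc, ho, h0, hu, hs.const_mul (inv_ne_zero hne), inv_mul_cancel₀ hne⟩
  choose W s hc ho h0 hu hs h1 using hex
  have hagree : ∀ u v w, w ∈ W u → w ∈ W v → ∀ i, proj L w ∈ E.U i → s u i w = s v i w := by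
    intro u v w hwu hwv i hi
    obtain ⟨K, -, h⟩ := ((hs v).mono Set.inter_subset_right).exists_eq_const_mul
      ((hs u).mono Set.inter_subset_left) ((ho u).inter (ho v))
      ((hc u).inter (hc v)).isPreconnected
    have hK := h i₀ 0 ⟨h0 u, h0 v⟩ hi₀
    rw [h1, h1, mul_one] at hK
    rw [h i w ⟨hwu, hwv⟩ hi, ← hK, one_mul]
  refine ⟨fun i u ↦ s u i u, isFrameOn_univ_iff.1 (isFrameOn_of_local fun u _ ↦ ?_)⟩
  exact ⟨s u, W u, ho u, hu u, hs u, fun i v hv hi ↦ hagree v u v (hu v) hv i hi⟩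

/-- A connection has a monodromy. -/
lemma exists_hasMonodromy (E : Connection L) : ∃ ρ, E.HasMonodromy ρ := by
  obtain ⟨s, hs⟩ := E.exists_isHorizontalFrame
  have hs' := isFrameOn_univ_iff.2 hs
  -- The data of `E` live on `C`, so the translate of a horizontal frame is again one, and hence a
  -- constant multiple of it.
  have hshift : ∀ γ : L.lattice, ∃ K : ℂ, K ≠ 0 ∧ ∀ i u, proj L u ∈ E.U i →
      s i (u + γ) = K * s i u := by
    intro γ
    have h2 : E.IsFrameOn (fun i u ↦ s i (u + γ)) Set.univ := by
      refine ⟨fun i u _ hi ↦ ?_, fun i j u _ hi hj ↦ ?_, fun i u _ hi ↦ ?_⟩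
      · exact hs'.ne_zero i _ trivial (by rwa [proj_add])
      · have := hs'.glue i j (u + γ) trivial (by rwa [proj_add]) (by rwa [proj_add])
        rwa [proj_add] at this
      · have := (hs'.horizontal i (u + γ) trivial (by rwa [proj_add])).comp_add_const u (γ : ℂ)
        rwa [proj_add] at this
    obtain ⟨K, hK, h⟩ := hs'.exists_eq_const_mul h2 isOpen_univ isPreconnected_univ
    exact ⟨K, hK, fun i u hi ↦ h i u trivial hi⟩
  choose K hK h using hshift
  obtain ⟨i₀, hi₀⟩ := E.cover (proj L 0)
  have hadd : ∀ γ δ, K (γ + δ) = K γ * K δ := by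
    intro γ δ
    apply mul_right_cancel₀ (hs.ne_zero i₀ 0 hi₀)
    rw [← h _ _ _ hi₀, Submodule.coe_add, add_comm (γ : ℂ), ← add_assoc,
      h γ i₀ (0 + δ) (by rwa [proj_add]), h δ i₀ 0 hi₀, mul_assoc]
  refine ⟨MonoidHom.mk' (fun γ ↦ Units.mk0 (K γ.toAdd) (hK _)) fun γ δ ↦ Units.ext ?_, s, hs,
    fun i u hu γ ↦ h γ i u hu⟩
  exact hadd γ.toAdd δ.toAdd

lemma hasMonodromy_unique {ρ ρ' : Multiplicative L.lattice →* ℂˣ} (h : E.HasMonodromy ρ)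
    (h' : E.HasMonodromy ρ') : ρ = ρ' := by
  obtain ⟨s, hs, hρ⟩ := h
  obtain ⟨s', hs', hρ'⟩ := h'
  obtain ⟨K, hK, e⟩ := (isFrameOn_univ_iff.2 hs).exists_eq_const_mul (isFrameOn_univ_iff.2 hs')
    isOpen_univ isPreconnected_univ
  obtain ⟨i, hi⟩ := E.cover (proj L 0)
  refine MonoidHom.ext fun γ ↦ Units.ext ?_
  have h1 := hρ i 0 hi γ.toAdd
  have h2 := hρ' i 0 hi γ.toAdd
  rw [e i _ trivial (by rwa [proj_add]), e i _ trivial hi, h1] at h2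
  apply mul_right_cancel₀ (mul_ne_zero hK (hs.ne_zero i 0 hi))
  simp only [ofAdd_toAdd] at h2
  linear_combination h2

end Connection

/-! ### Multivalued solutions and monodromy -/

/-- The punctured disc is the image of a half-plane under `w ↦ u + exp w`. -/
lemma isPreconnected_punctured_ball (u : ℂ) {r : ℝ} (hr : 0 < r) :
    IsPreconnected (Metric.ball u r \ {u}) := by
  have h : Metric.ball u r \ {u} = (fun w ↦ u + exp w) '' {w : ℂ | w.re < Real.log r} := by
    ext z
    simp only [Set.mem_sdiff, Metric.mem_ball, Set.mem_singleton_iff, Set.mem_image, dist_eq_norm]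
    constructor
    · rintro ⟨h1, h2⟩
      have h3 : z - u ≠ 0 := sub_ne_zero.2 h2
      refine ⟨log (z - u), ?_, by rw [exp_log h3]; ring⟩
      change (log (z - u)).re < _
      rw [log_re]
      exact Real.log_lt_log (norm_pos_iff.2 h3) h1
    · rintro ⟨w, hw, rfl⟩
      have hw : w.re < Real.log r := hw
      refine ⟨?_, by simp⟩
      rw [add_sub_cancel_left, norm_exp]
      exact (Real.lt_log_iff_exp_lt hr).1 hw
  rw [h]
  exact (convex_halfSpace_re_lt _).isPreconnected.image _ (by fun_prop)

lemma eventually_eq_const_of_hasDerivAt_zero {f : ℂ → ℂ} {u : ℂ}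
    (h : ∀ᶠ w in 𝓝[≠] u, HasDerivAt f 0 w) : ∃ K, ∀ᶠ w in 𝓝[≠] u, f w = K := by
  obtain ⟨r, hr, hsub⟩ := Metric.mem_nhdsWithin_iff.1 h
  have ho : IsOpen (Metric.ball u r \ {u}) := Metric.isOpen_ball.sdiff isClosed_singleton
  obtain ⟨K, hK⟩ := ho.exists_is_const_of_deriv_eq_zero (isPreconnected_punctured_ball u hr)
    (f := f) (fun w hw ↦ (show HasDerivAt f 0 w from hsub hw).differentiableAt.differentiableWithinAt)
    (fun w hw ↦ (show HasDerivAt f 0 w from hsub hw).deriv)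
  exact ⟨K, mem_of_superset (Metric.mem_nhdsWithin_iff.2 ⟨r, hr, subset_rfl⟩) hK⟩

/-- `z` is a multivalued meromorphic solution of `dz / z = f du` with multipliers `ρ`. -/
structure IsSolution (ρ : Multiplicative L.lattice →* ℂˣ) (f z : ℂ → ℂ) : Prop where
  meromorphic : ∀ u, MeromorphicAt z u
  hasDerivAt : ∀ u, ∀ᶠ w in 𝓝[≠] u, z w ≠ 0 ∧ HasDerivAt z (f w * z w) w
  multiplier : ∀ u, ∀ γ : L.lattice, z (u + γ) = ρ (.ofAdd γ) * z u

lemma eventually_add_notMem_lattice (L : PeriodPair) (u a : ℂ) :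
    ∀ᶠ w in 𝓝[≠] u, w + a ∉ L.lattice := by
  have h : Tendsto (fun w ↦ w + a) (𝓝[≠] u) (𝓝[≠] (u + a)) := by
    refine tendsto_nhdsWithin_of_tendsto_nhds_of_eventually_within _
      ((continuous_add_const a).tendsto u |>.mono_left nhdsWithin_le_nhds) ?_
    filter_upwards [self_mem_nhdsWithin] with w hw h
    exact hw (add_right_cancel h)
  exact h.eventually (eventually_notMem_lattice L (u + a))

/-- By `sigma_mul_sigma`, the difference `℘(u) - ℘(v)` vanishes only where `σ(u - v)` or `σ(u + v)`
does. -/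
lemma weierstrassP_ne {u v : ℂ} (hu : u ∉ L.lattice) (hv : v ∉ L.lattice)
    (h1 : u + -v ∉ L.lattice) (h2 : u + v ∉ L.lattice) : ℘[L] u ≠ ℘[L] v := by
  intro h
  have := sigma_mul_sigma hu hv
  rw [h, sub_self, mul_zero, sub_eq_add_neg] at this
  exact mul_ne_zero (sigma_ne_zero h1) (sigma_ne_zero h2) this

lemma isSolution_solution {u₀ : ℂ} (h0 : u₀ ∉ L.lattice) (c : ℂ) :
    IsSolution (chi L u₀ (c + zeta L u₀)) (mainForm L u₀ c) (solution L u₀ c) where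
  meromorphic u := by
    have h := differentiable_sigma L
    exact .mul (.div (Differentiable.analyticAt (by fun_prop) u).meromorphicAt
      (h.analyticAt u).meromorphicAt) (Differentiable.analyticAt (by fun_prop) u).meromorphicAt
  hasDerivAt u := by
    filter_upwards [eventually_notMem_lattice L u, eventually_add_notMem_lattice L u u₀,
      eventually_add_notMem_lattice L u (-u₀)] with w h1 h2 h3
    refine ⟨mul_ne_zero (div_ne_zero (sigma_ne_zero ?_) (sigma_ne_zero h1)) (exp_ne_zero _),
      hasDerivAt_solution c h1 h0 (weierstrassP_ne h1 h0 h3 h2)⟩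
    rwa [sub_eq_add_neg]
  multiplier u γ := by
    rw [solution_add, chi_apply]
    ring_nf

lemma isSolution_exp (L : PeriodPair) (c₀ : ℂ) :
    IsSolution (chi L 0 c₀) (fun _ ↦ c₀) (fun u ↦ exp (c₀ * u)) where
  meromorphic u := (Differentiable.analyticAt (by fun_prop) u).meromorphicAt
  hasDerivAt u := .of_forall fun w ↦ ⟨exp_ne_zero _, by
    convert! ((hasDerivAt_id w).const_mul c₀).cexp using 1
    simp only [id]
    ring⟩
  multiplier u γ := by
    rw [chi_apply, ← exp_add]
    ring_nf

/-- A section of `ℂ → C`. -/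
def liftC (L : PeriodPair) (x : Curve L) : ℂ := Function.surjInv (proj_surjective L) x

lemma proj_liftC (L : PeriodPair) (x : Curve L) : proj L (liftC L x) = x :=
  Function.surjInv_eq _ x

lemma exists_liftC_proj (L : PeriodPair) (u : ℂ) :
    ∃ γ : L.lattice, liftC L (proj L u) = u + γ :=
  exists_of_proj_eq (proj_liftC L _).symm

namespace Connection

variable {E E' : Connection L} {ρ ρ' : Multiplicative L.lattice →* ℂˣ}

/-- The frame `s` and the solution `z` have the same multipliers, so `s / z` descends to `C` and is
the required meromorphic section. The lift `liftC` is not continuous, but periodicity makes the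
choice harmless. -/
lemma HasMonodromy.hasForm {f z : ℂ → ℂ} (h : E.HasMonodromy ρ) (hz : IsSolution ρ f z) :
    E.HasForm f := by
  obtain ⟨s, hs, hρ⟩ := h
  have key : ∀ i u, proj L u ∈ E.U i →
      s i (liftC L (proj L u)) / z (liftC L (proj L u)) = s i u / z u := by
    intro i u hi
    obtain ⟨γ, hγ⟩ := exists_liftC_proj L u
    rw [hγ, hρ i u hi, hz.multiplier, mul_div_mul_left _ _ (Units.ne_zero _)]
  have hnear : ∀ i, ∀ u ∈ proj L ⁻¹' E.U i, ∀ᶠ w in 𝓝 u, proj L w ∈ E.U i := fun i u hi ↦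
    (isOpen_preimage_U E.toLineBundle i).mem_nhds hi
  have hev : ∀ i, ∀ u ∈ proj L ⁻¹' E.U i,
      (fun u ↦ s i (liftC L (proj L u)) / z (liftC L (proj L u))) =ᶠ[𝓝 u] fun u ↦ s i u / z u :=
    fun i u hi ↦ (hnear i u hi).mono fun w hw ↦ key i w hw
  refine ⟨fun i x ↦ s i (liftC L x) / z (liftC L x), ?_, ?_, ?_, ?_⟩
  · intro i u hi
    have h1 : AnalyticAt ℂ (s i) u :=
      DifferentiableOn.analyticAt (s := proj L ⁻¹' E.U i)
        (fun w hw ↦ (hs.horizontal i w hw).differentiableAt.differentiableWithinAt)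
        (hnear i u hi)
    exact (h1.meromorphicAt.div (hz.meromorphic u)).congr
      ((hev i u hi).symm.filter_mono nhdsWithin_le_nhds)
  · intro i u hi
    filter_upwards [hz.hasDerivAt u, nhdsWithin_le_nhds (hnear i u hi)] with w h1 h2
    rw [key i w h2]
    exact div_ne_zero (hs.ne_zero i w h2) h1.1
  · intro i j u hij
    filter_upwards [nhdsWithin_le_nhds (hnear i u hij.1), nhdsWithin_le_nhds (hnear j u hij.2)]
      with w h1 h2
    rw [key i w h1, key j w h2, hs.glue i j w ⟨h1, h2⟩, mul_div_assoc]
  · intro i u hi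
    filter_upwards [hz.hasDerivAt u, nhdsWithin_le_nhds (hnear i u hi)] with w h1 h2
    rw [(hev i w h2).deriv_eq, key i w h2]
    rw [((hs.horizontal i w h2).fun_div h1.2 h1.1).deriv]
    have := h1.1
    field_simp

/-- With `t` the meromorphic section and `s` a horizontal frame, `tz / s` has derivative zero off
the singular points. It is thus one nonzero constant, so `z` and `s` have the same multipliers. -/
lemma HasForm.hasMonodromy {f z : ℂ → ℂ} (h : E.HasForm f) (hz : IsSolution ρ f z) :
    E.HasMonodromy ρ := by
  obtain ⟨t, ht_mer, ht_ne, ht_glue, ht_der⟩ := h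
  obtain ⟨ρ', hmon⟩ := E.exists_hasMonodromy
  obtain ⟨s, hs, hρ⟩ := hmon
  have hnear : ∀ i, ∀ u ∈ proj L ⁻¹' E.U i, ∀ᶠ w in 𝓝 u, proj L w ∈ E.U i := fun i u hi ↦
    (isOpen_preimage_U E.toLineBundle i).mem_nhds hi
  -- `P u K` says that `tz = Ks` near `u`, except perhaps at `u`, in every index; this allows for
  -- the zeros and poles of `t` and `z`.
  set P : ℂ → ℂ → Prop := fun u K ↦ ∀ i, proj L u ∈ E.U i →
    ∀ᶠ w in 𝓝[≠] u, t i (proj L w) * z w = K * s i w with hP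
  have hP1 : ∀ u i K, proj L u ∈ E.U i →
      (∀ᶠ w in 𝓝[≠] u, t i (proj L w) * z w = K * s i w) → P u K := by
    intro u i K hi hK j hj
    filter_upwards [hK, ht_glue j i u ⟨hj, hi⟩, nhdsWithin_le_nhds (hnear i u hi),
      nhdsWithin_le_nhds (hnear j u hj)] with w h1 h2 h3 h4
    rw [h2, hs.glue j i w ⟨h4, h3⟩, mul_assoc, h1]
    ring
  have hex : ∀ u, ∃ K, P u K := by
    intro u
    obtain ⟨i, hi⟩ := E.cover (proj L u)
    have hder : ∀ᶠ w in 𝓝[≠] u, HasDerivAt (fun w ↦ t i (proj L w) * z w / s i w) 0 w := by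
      filter_upwards [ht_der i u hi, hz.hasDerivAt u, (ht_mer i u hi).eventually_analyticAt,
        nhdsWithin_le_nhds (hnear i u hi)] with w h1 h2 h3 h4
      have h5 := h3.differentiableAt.hasDerivAt
      rw [h1] at h5
      have hne := hs.ne_zero i w h4
      convert! (h5.mul h2.2).div (hs.horizontal i w h4) hne using 1
      simp only [Pi.mul_apply]
      field_simp
      ring
    obtain ⟨K, hK⟩ := eventually_eq_const_of_hasDerivAt_zero hder
    refine ⟨K, hP1 u i K hi ?_⟩
    filter_upwards [hK, nhdsWithin_le_nhds (hnear i u hi)] with w h1 h2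
    rw [← h1, div_mul_cancel₀ _ (hs.ne_zero i w h2)]
  have huniq : ∀ u K K', P u K → P u K' → K = K' := by
    intro u K K' hK hK'
    obtain ⟨i, hi⟩ := E.cover (proj L u)
    obtain ⟨w, h1, h2, h3⟩ := ((hK i hi).and ((hK' i hi).and
      (nhdsWithin_le_nhds (hnear i u hi)))).exists
    exact mul_right_cancel₀ (hs.ne_zero i w h3) (h1.symm.trans h2)
  choose κ hκ using hex
  have hloc : IsLocallyConstant κ := by
    refine (IsLocallyConstant.iff_eventually_eq κ).2 fun u ↦ ?_
    obtain ⟨i, hi⟩ := E.cover (proj L u)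
    have h1 := eventually_nhdsWithin_iff.1 (eventually_eventually_nhdsWithin.2 (hκ u i hi))
    filter_upwards [h1, hnear i u hi] with v hv hvi
    by_cases hvu : v = u
    · rw [hvu]
    · refine huniq v _ _ (hκ v) (hP1 v i _ hvi ?_)
      have := hv hvu
      rw [IsOpen.nhdsWithin_eq isOpen_compl_singleton hvu] at this
      exact this.filter_mono nhdsWithin_le_nhds
  suffices ρ' = ρ by
    rw [← this]
    exact ⟨s, hs, hρ⟩
  refine MonoidHom.ext fun δ ↦ Units.ext ?_
  obtain ⟨γ, rfl⟩ := Multiplicative.ofAdd.surjective δ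
  obtain ⟨i, hi⟩ := E.cover (proj L 0)
  have hi' : proj L (0 + γ) ∈ E.U i := by rwa [proj_add]
  have hshift : Tendsto (fun w : ℂ ↦ w + γ) (𝓝[≠] 0) (𝓝[≠] (0 + γ)) := by
    refine tendsto_nhdsWithin_of_tendsto_nhds_of_eventually_within _
      ((continuous_add_const (γ : ℂ)).tendsto 0 |>.mono_left nhdsWithin_le_nhds) ?_
    filter_upwards [self_mem_nhdsWithin] with w hw h
    exact hw (add_right_cancel h)
  have e1 := hshift.eventually (hκ (0 + γ) i hi')
  rw [hloc.apply_eq_of_preconnectedSpace (0 + γ) 0] at e1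
  obtain ⟨w, h1, h2, h3, h4, h5⟩ := (e1.and ((hκ 0 i hi).and ((ht_ne i 0 hi).and
    ((hz.hasDerivAt 0).and (nhdsWithin_le_nhds (hnear i 0 hi)))))).exists
  rw [proj_add, hz.multiplier, hρ i w h5] at h1
  have h6 : κ 0 * s i w ≠ 0 := by
    rw [← h2]
    exact mul_ne_zero h3 h4.1
  apply mul_right_cancel₀ h6
  linear_combination -h1 + (ρ (.ofAdd γ) : ℂ) * h2

lemma hasParameter_iff {p : A₀ L} : E.HasParameter p ↔ E.HasMonodromy (character L p) := by
  constructor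
  · rintro (⟨u₀, c, h0, rfl, hE⟩ | ⟨c₀, rfl, hE⟩)
    · rw [mainPoint_eq h0, character_point]
      exact hE.hasMonodromy (isSolution_solution h0 c)
    · rw [zeroPoint_eq, character_point]
      exact hE.hasMonodromy (isSolution_exp L c₀)
  · intro h
    obtain ⟨x, w, rfl⟩ := exists_point_eq p
    -- Over `0 ∈ C` the representative is moved to `x = 0`, where the exponential replaces the sigma
    -- quotient.
    by_cases hx : x ∈ L.lattice
    · have e : point L x w = point L 0 (w - quasiPeriod L ⟨x, hx⟩) :=
        (point_eq_iff.2 ⟨⟨x, hx⟩, by simp, by simp⟩).symm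
      rw [e] at h ⊢
      rw [character_point] at h
      exact .inr ⟨_, (zeroPoint_eq L _).symm, h.hasForm (isSolution_exp L _)⟩
    · refine .inl ⟨x, w - zeta L x, hx, ?_, ?_⟩
      · rw [mainPoint_eq hx, sub_add_cancel]
      · rw [character_point, ← sub_add_cancel w (zeta L x)] at h
        exact h.hasForm (isSolution_solution hx _)

lemma existsUnique_hasParameter (E : Connection L) : ∃! p, E.HasParameter p := by
  obtain ⟨ρ, hρ⟩ := E.exists_hasMonodromy
  obtain ⟨p, rfl⟩ := character_surjective L ρ
  refine ⟨p, hasParameter_iff.2 hρ, fun q hq ↦ ?_⟩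
  exact character_injective L (hasMonodromy_unique (hasParameter_iff.1 hq) hρ)

lemma HasParameter.hasMonodromy_iff {p : A₀ L} (h : E.HasParameter p) :
    E.HasMonodromy ρ ↔ rhMap L p = (ρ (.ofAdd (gen₁ L)), ρ (.ofAdd (gen₂ L))) := by
  rw [rhMap_eq_iff]
  refine ⟨fun h' ↦ hasMonodromy_unique (hasParameter_iff.1 h) h', ?_⟩
  rintro rfl
  exact hasParameter_iff.1 h

lemma HasMonodromy.tensor (h : E.HasMonodromy ρ) (h' : E'.HasMonodromy ρ') :
    (E.tensor E').HasMonodromy (ρ * ρ') := by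
  obtain ⟨s, hs, hρ⟩ := h
  obtain ⟨s', hs', hρ'⟩ := h'
  refine ⟨fun i u ↦ s i.1 u * s' i.2 u, ⟨fun i u hu ↦ ?_, fun i j u hu ↦ ?_, fun i u hu ↦ ?_⟩,
    fun i u hu γ ↦ ?_⟩
  · exact mul_ne_zero (hs.ne_zero _ u hu.1) (hs'.ne_zero _ u hu.2)
  · rw [hs.glue i.1 j.1 u ⟨hu.1.1, hu.2.1⟩, hs'.glue i.2 j.2 u ⟨hu.1.2, hu.2.2⟩]
    simp only [Connection.tensor]
    ring
  · convert! (hs.horizontal i.1 u hu.1).mul (hs'.horizontal i.2 u hu.2) using 1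
    simp only [Connection.tensor]
    ring
  · change s i.1 (u + γ) * s' i.2 (u + γ) = _ * (s i.1 u * s' i.2 u)
    rw [hρ i.1 u hu.1, hρ' i.2 u hu.2, MonoidHom.mul_apply, Units.val_mul]
    ring

lemma rhMap_tensor {p p' q : A₀ L} (h : E.HasParameter p) (h' : E'.HasParameter p')
    (hq : (E.tensor E').HasParameter q) : rhMap L q = rhMap L p * rhMap L p' := by
  have := (hasParameter_iff.1 h).tensor (hasParameter_iff.1 h')
  rw [hq.hasMonodromy_iff] at this
  exact this

end Connection

/-! ### Flat line bundles -/

/-- A local inverse of `ℂ → C` at `x`. -/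
def localLift (L : PeriodPair) (x : Curve L) : OpenPartialHomeomorph (Curve L) ℂ :=
  (isLocalHomeomorph_proj L (liftC L x)).choose.symm

lemma mem_localLift_source (L : PeriodPair) (x : Curve L) : x ∈ (localLift L x).source := by
  have h := (isLocalHomeomorph_proj L (liftC L x)).choose_spec
  have h1 := (isLocalHomeomorph_proj L (liftC L x)).choose.map_source h.1
  rw [← h.2, proj_liftC] at h1
  exact h1

lemma proj_localLift {x y : Curve L} (hy : y ∈ (localLift L x).source) :
    proj L (localLift L x y) = y := by
  have h := (isLocalHomeomorph_proj L (liftC L x)).choose_spec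
  conv_lhs => rw [h.2]
  exact (isLocalHomeomorph_proj L (liftC L x)).choose.right_inv hy

lemma sub_mem_lattice {u v : ℂ} (h : proj L u = proj L v) : u - v ∈ L.lattice := by
  obtain ⟨γ, hγ⟩ := exists_of_proj_eq h.symm
  rw [hγ, add_sub_cancel_left]
  exact γ.2

/-- A continuous function with values in the lattice is locally constant. -/
lemma eventually_eq_of_mem_lattice {f : ℂ → ℂ} {u : ℂ} (hf : ContinuousAt f u)
    (h : ∀ᶠ w in 𝓝 u, f w ∈ L.lattice) : ∀ᶠ w in 𝓝 u, f w = f u := by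
  filter_upwards [h, hf.eventually (L.compl_lattice_sdiff_singleton_mem_nhds (f u))] with w h1 h2
  by_contra h3
  exact h2 ⟨h1, h3⟩

open Classical in
/-- The extension by `1` of a character to `ℂ`. -/
def extendChar (ρ : Multiplicative L.lattice →* ℂˣ) (d : ℂ) : ℂ :=
  if h : d ∈ L.lattice then (ρ (.ofAdd ⟨d, h⟩) : ℂ) else 1

lemma extendChar_coe (ρ : Multiplicative L.lattice →* ℂˣ) (γ : L.lattice) :
    extendChar ρ γ = ρ (.ofAdd γ) := dif_pos γ.2

lemma extendChar_ne_zero (ρ : Multiplicative L.lattice →* ℂˣ) (d : ℂ) : extendChar ρ d ≠ 0 := by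
  rw [extendChar]
  split_ifs
  · exact Units.ne_zero _
  · exact one_ne_zero

lemma extendChar_add (ρ : Multiplicative L.lattice →* ℂˣ) {d e : ℂ} (hd : d ∈ L.lattice)
    (he : e ∈ L.lattice) : extendChar ρ (d + e) = extendChar ρ d * extendChar ρ e := by
  have h1 := extendChar_coe ρ (⟨d, hd⟩ + ⟨e, he⟩)
  have h2 := extendChar_coe ρ ⟨d, hd⟩
  have h3 := extendChar_coe ρ ⟨e, he⟩
  rw [ofAdd_add, map_mul, Units.val_mul, ← h2, ← h3] at h1
  exact h1

/-- Two local inverses of `ℂ → C` differ by a continuous function with values in the discrete group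
`Λ`. -/
lemma eventually_extendChar_const (ρ : Multiplicative L.lattice →* ℂˣ) (x y : Curve L) {u : ℂ}
    (hx : proj L u ∈ (localLift L x).source) (hy : proj L u ∈ (localLift L y).source) :
    (fun w ↦ extendChar ρ (localLift L y (proj L w) - localLift L x (proj L w))) =ᶠ[𝓝 u]
      fun _ ↦ extendChar ρ (localLift L y (proj L u) - localLift L x (proj L u)) := by
  have hc : ∀ z, proj L u ∈ (localLift L z).source →
      ContinuousAt (fun w ↦ localLift L z (proj L w)) u := fun z hz ↦
    ((localLift L z).continuousAt hz).comp (continuous_proj L).continuousAt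
  have hn : ∀ z, proj L u ∈ (localLift L z).source →
      ∀ᶠ w in 𝓝 u, proj L w ∈ (localLift L z).source := fun z hz ↦
    (((localLift L z).open_source).preimage (continuous_proj L)).mem_nhds hz
  have h := eventually_eq_of_mem_lattice (L := L) ((hc y hy).sub (hc x hx)) ?_
  · filter_upwards [h] with w hw
    rw [Pi.sub_apply, Pi.sub_apply] at hw
    rw [hw]
  · filter_upwards [hn x hx, hn y hy] with w h1 h2
    exact sub_mem_lattice (by rw [proj_localLift h1, proj_localLift h2])

/-- The flat connection with given monodromy. -/
def flatConnection (ρ : Multiplicative L.lattice →* ℂˣ) : Connection L where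
  ι := Curve L
  U x := (localLift L x).source
  isOpen_U x := (localLift L x).open_source
  cover x := ⟨x, mem_localLift_source L x⟩
  -- On overlaps the argument lies in `Λ`; the value `1` given by `extendChar` off `Λ` plays no
  -- role.
  g x y b := extendChar ρ (localLift L y b - localLift L x b)
  holomorphic_g x y u hu :=
    ((eventually_extendChar_const ρ x y hu.1 hu.2).differentiableAt_iff.2
      (differentiableAt_const _)).differentiableWithinAt
  g_ne_zero x y b _ := extendChar_ne_zero _ _
  cocycle x y z b hb := by
    rw [← extendChar_add ρ, add_comm, sub_add_sub_cancel]
    · exact sub_mem_lattice (by rw [proj_localLift hb.1.1, proj_localLift hb.1.2])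
    · exact sub_mem_lattice (by rw [proj_localLift hb.2, proj_localLift hb.1.2])
  a _ _ := 0
  holomorphic_a _ := differentiableOn_const _
  compatible x y u hu := by
    rw [(eventually_extendChar_const ρ x y hu.1 hu.2).deriv_eq, deriv_const, sub_zero, zero_mul]

/-- The frame at `u` is `ρ` of the lattice vector from the chosen lift of `proj L u` to `u`; it is
locally constant and is multiplied by `ρ(γ)` along `γ`. -/
lemma flatConnection_hasMonodromy (ρ : Multiplicative L.lattice →* ℂˣ) :
    (flatConnection ρ).HasMonodromy ρ := by
  have hmem : ∀ x u, proj L u ∈ (localLift L x).source →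
      u - localLift L x (proj L u) ∈ L.lattice := fun x u hu ↦
    sub_mem_lattice (by rw [proj_localLift hu])
  refine ⟨fun x u ↦ extendChar ρ (u - localLift L x (proj L u)),
    ⟨fun x u hu ↦ extendChar_ne_zero _ _, fun x y u hu ↦ ?_, fun x u hu ↦ ?_⟩, fun x u hu γ ↦ ?_⟩
  · change _ = extendChar ρ _ * _
    rw [← extendChar_add ρ _ (hmem y u hu.2), add_comm, sub_add_sub_cancel]
    exact sub_mem_lattice (by rw [proj_localLift hu.1, proj_localLift hu.2])
  · have hcont : ContinuousAt (fun w ↦ w - localLift L x (proj L w)) u :=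
      continuousAt_id.sub (((localLift L x).continuousAt hu).comp (continuous_proj L).continuousAt)
    have hn : ∀ᶠ w in 𝓝 u, proj L w ∈ (localLift L x).source :=
      (((localLift L x).open_source).preimage (continuous_proj L)).mem_nhds hu
    have h := eventually_eq_of_mem_lattice (L := L) hcont (hn.mono fun w hw ↦ hmem x w hw)
    change HasDerivAt _ (0 * _) u
    rw [zero_mul]
    refine (hasDerivAt_const u (extendChar ρ (u - localLift L x (proj L u)))).congr_of_eventuallyEq (h.mono fun w hw ↦ ?_)
    exact congrArg (extendChar ρ) hw
  · change extendChar ρ (u + γ - localLift L x (proj L (u + γ))) =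
      _ * extendChar ρ (u - localLift L x (proj L u))
    rw [proj_add, ← extendChar_coe, ← extendChar_add ρ γ.2 (hmem x u hu)]
    ring_nf

lemma exists_hasParameter (p : A₀ L) : ∃ E : Connection L, E.HasParameter p :=
  ⟨_, Connection.hasParameter_iff.2 (flatConnection_hasMonodromy _)⟩

/-! ### Isomorphisms -/

namespace Connection

variable {E E' : Connection L} {ρ ρ' : Multiplicative L.lattice →* ℂˣ}

/-- For frames `s` and `s'`, the ratio `(s' / s) exp(-au)` is periodic and descends to `C`. It
respects the connections when `a = 0`; other `a` give isomorphisms of line bundles only. -/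
lemma exists_isIso (hE : E.HasMonodromy ρ) (hE' : E'.HasMonodromy ρ') (a : ℂ)
    (hρ : ∀ γ : L.lattice, (ρ' (.ofAdd γ) : ℂ) = ρ (.ofAdd γ) * exp (a * γ)) :
    ∃ h, LineBundle.IsIso E.toLineBundle E'.toLineBundle h ∧
      ∀ k i, ∀ u ∈ proj L ⁻¹' (E'.U k ∩ E.U i), deriv (fun w ↦ h k i (proj L w)) u =
        (E'.a k (proj L u) - E.a i (proj L u) - a) * h k i (proj L u) := by
  obtain ⟨s, hs, hm⟩ := hE
  obtain ⟨s', hs', hm'⟩ := hE'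
  set h : E'.ι → E.ι → Curve L → ℂ := fun k i x ↦
    s' k (liftC L x) / s i (liftC L x) * exp (-a * liftC L x) with hh
  have key : ∀ k i u, proj L u ∈ E'.U k → proj L u ∈ E.U i →
      h k i (proj L u) = s' k u / s i u * exp (-a * u) := by
    intro k i u hk hi
    obtain ⟨γ, hγ⟩ := exists_liftC_proj L u
    have h1 := hs.ne_zero i u hi
    have h2 := Units.ne_zero (ρ (.ofAdd γ))
    have h3 := exp_ne_zero (a * γ)
    simp only [hh]
    rw [hγ, hm i u hi, hm' k u hk, hρ, mul_add, exp_add, neg_mul, neg_mul, exp_neg (a * γ)]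
    field_simp
  have hev : ∀ k i, ∀ u ∈ proj L ⁻¹' (E'.U k ∩ E.U i),
      (fun w ↦ h k i (proj L w)) =ᶠ[𝓝 u] fun w ↦ s' k w / s i w * exp (-a * w) := by
    intro k i u hu
    filter_upwards [(isOpen_preimage_U E'.toLineBundle k).mem_nhds hu.1,
      (isOpen_preimage_U E.toLineBundle i).mem_nhds hu.2] with w h1 h2 using key k i w h1 h2
  have hder : ∀ k i, ∀ u ∈ proj L ⁻¹' (E'.U k ∩ E.U i), HasDerivAt (fun w ↦ h k i (proj L w))
      ((E'.a k (proj L u) - E.a i (proj L u) - a) * h k i (proj L u)) u := by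
    intro k i u hu
    refine HasDerivAt.congr_of_eventuallyEq ?_ (hev k i u hu)
    have h1 := hs.ne_zero i u hu.2
    convert! ((hs'.horizontal k u hu.1).div (hs.horizontal i u hu.2) h1).mul
      ((hasDerivAt_id u).const_mul (-a)).cexp using 1
    rw [key k i u hu.1 hu.2]
    simp only [id, Pi.div_apply]
    field_simp
    ring
  refine ⟨h, ⟨fun k i u hu ↦ (hder k i u hu).differentiableAt.differentiableWithinAt,
    fun k i x hx ↦ ?_, fun k l i j x hx ↦ ?_⟩, fun k i u hu ↦ (hder k i u hu).deriv⟩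
  · obtain ⟨u, rfl⟩ := proj_surjective L x
    rw [key k i u hx.1 hx.2]
    exact mul_ne_zero (div_ne_zero (hs'.ne_zero k u hx.1) (hs.ne_zero i u hx.2)) (exp_ne_zero _)
  · obtain ⟨u, rfl⟩ := proj_surjective L x
    obtain ⟨⟨hk, hl⟩, hi, hj⟩ := hx
    rw [key k i u hk hi, key l j u hl hj, hs'.glue k l u ⟨hk, hl⟩, hs.glue i j u ⟨hi, hj⟩]
    have h1 := hs.ne_zero j u hj
    have h2 := E.g_ne_zero i j (proj L u) ⟨hi, hj⟩
    field_simp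

/-- The function `φ = s' / (hs)` is entire without zeros, with multipliers `ρ' / ρ`. Its logarithmic
derivative is elliptic and entire, hence a constant `a`, so `φ` is a multiple of `exp(au)`; if `h`
respects the connections, `φ` is constant. -/
lemma exists_of_isIso (hE : E.HasMonodromy ρ) (hE' : E'.HasMonodromy ρ')
    {h : E'.ι → E.ι → Curve L → ℂ} (hh : LineBundle.IsIso E.toLineBundle E'.toLineBundle h) :
    (∃ a : ℂ, ∀ γ : L.lattice, (ρ' (.ofAdd γ) : ℂ) = ρ (.ofAdd γ) * exp (a * γ)) ∧
    ((∀ k i, ∀ u ∈ proj L ⁻¹' (E'.U k ∩ E.U i), deriv (fun w ↦ h k i (proj L w)) u =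
        (E'.a k (proj L u) - E.a i (proj L u)) * h k i (proj L u)) → ρ' = ρ) := by
  obtain ⟨s, hs, hm⟩ := hE
  obtain ⟨s', hs', hm'⟩ := hE'
  choose idx hidx using E.cover
  choose idx' hidx' using E'.cover
  set φ : ℂ → ℂ := fun u ↦ s' (idx' (proj L u)) u /
    (h (idx' (proj L u)) (idx (proj L u)) (proj L u) * s (idx (proj L u)) u) with hφ
  have key : ∀ k i u, proj L u ∈ E'.U k → proj L u ∈ E.U i →
      φ u = s' k u / (h k i (proj L u) * s i u) := by
    intro k i u hk hi
    have hl := hidx' (proj L u)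
    have hj := hidx (proj L u)
    simp only [hφ]
    set l := idx' (proj L u)
    set j := idx (proj L u)
    have e1 := hs'.glue k l u ⟨hk, hl⟩
    have e2 := hs.glue i j u ⟨hi, hj⟩
    have e3 := hh.compatible k l i j (proj L u) ⟨⟨hk, hl⟩, hi, hj⟩
    have n1 := E'.g_ne_zero k l (proj L u) ⟨hk, hl⟩
    rw [e1, e2, ← mul_assoc, e3, mul_assoc, mul_div_mul_left _ _ n1]
  have hne : ∀ u, φ u ≠ 0 := fun u ↦
    div_ne_zero (hs'.ne_zero _ u (hidx' _))
      (mul_ne_zero (hh.ne_zero _ _ _ ⟨hidx' _, hidx _⟩) (hs.ne_zero _ u (hidx _)))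
  have hper : ∀ u, ∀ γ : L.lattice,
      φ (u + γ) = (ρ' (.ofAdd γ) : ℂ) / ρ (.ofAdd γ) * φ u := by
    intro u γ
    simp only [hφ, proj_add]
    rw [hm' _ u (hidx' _), hm _ u (hidx _)]
    have := Units.ne_zero (ρ (.ofAdd γ))
    field_simp
  have hder : ∀ k i u, proj L u ∈ E'.U k → proj L u ∈ E.U i → HasDerivAt φ
      ((E'.a k (proj L u) - E.a i (proj L u) -
        deriv (fun w ↦ h k i (proj L w)) u / h k i (proj L u)) * φ u) u := by
    intro k i u hk hi
    have n1 := hh.ne_zero k i (proj L u) ⟨hk, hi⟩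
    have n2 := hs.ne_zero i u hi
    have hd := ((hh.holomorphic k i).differentiableAt ((E'.isOpen_U k).inter (E.isOpen_U i))
      (u := u) ⟨hk, hi⟩).hasDerivAt
    have h1 : HasDerivAt (fun u ↦ s' k u / (h k i (proj L u) * s i u))
      ((E'.a k (proj L u) - E.a i (proj L u) -
        deriv (fun w ↦ h k i (proj L w)) u / h k i (proj L u)) *
          (s' k u / (h k i (proj L u) * s i u))) u := by
      convert! (hs'.horizontal k u hk).fun_div (hd.fun_mul (hs.horizontal i u hi))
        (mul_ne_zero n1 n2) using 1
      field_simp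
      ring
    rw [key k i u hk hi]
    refine h1.congr_of_eventuallyEq ?_
    filter_upwards [(isOpen_preimage_U E'.toLineBundle k).mem_nhds hk,
      (isOpen_preimage_U E.toLineBundle i).mem_nhds hi] with w h1 h2 using key k i w h1 h2
  have hdiff : Differentiable ℂ φ := fun u ↦
    (hder _ _ u (hidx' _) (hidx _)).differentiableAt
  constructor
  · have hlog : Differentiable ℂ (logDeriv φ) := fun u ↦
      ((hdiff.analyticAt u).deriv.div (hdiff.analyticAt u) (hne u)).differentiableAt
    have hlogper : ∀ u, ∀ γ : L.lattice, logDeriv φ (u + γ) = logDeriv φ u := by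
      intro u γ
      rw [logDeriv_apply, logDeriv_apply, ← deriv_comp_add_const]
      simp_rw [hper]
      rw [deriv_const_mul _ (hdiff u), mul_div_mul_left]
      exact div_ne_zero (Units.ne_zero _) (Units.ne_zero _)
    set a := logDeriv φ 0 with ha
    have hlogc : ∀ u, deriv φ u = a * φ u := fun u ↦ by
      rw [ha, ← eq_const_of_norm_periodic hlog (fun z γ ↦ by rw [hlogper z γ]) u 0, logDeriv_apply,
        div_mul_cancel₀ _ (hne u)]
    have hconst : ∀ u, φ u * exp (-a * u) = φ 0 * exp (-a * 0) := by
      intro u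
      have hd : ∀ u, HasDerivAt (fun u ↦ φ u * exp (-a * u)) 0 u := by
        intro u
        convert! (hdiff u).hasDerivAt.mul ((hasDerivAt_id u).const_mul (-a)).cexp using 1
        rw [hlogc]
        simp only [id]
        ring
      exact is_const_of_deriv_eq_zero (fun u ↦ (hd u).differentiableAt) (fun u ↦ (hd u).deriv) u 0
    refine ⟨a, fun γ ↦ ?_⟩
    have h1 := hconst (0 + γ)
    rw [hper, zero_add, mul_zero, exp_zero, mul_one, neg_mul, exp_neg] at h1
    have n1 := Units.ne_zero (ρ (.ofAdd γ))
    have n2 := exp_ne_zero (a * γ)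
    have n3 := hne 0
    field_simp at h1
    exact h1
  · intro hhor
    have hd : ∀ u, deriv φ u = 0 := by
      intro u
      have hi := hidx (proj L u)
      have hk := hidx' (proj L u)
      rw [(hder _ _ u hk hi).deriv, hhor _ _ u ⟨hk, hi⟩,
        mul_div_cancel_right₀ _ (hh.ne_zero _ _ _ ⟨hk, hi⟩), sub_self, zero_mul]
    refine MonoidHom.ext fun δ ↦ Units.ext ?_
    obtain ⟨γ, rfl⟩ := Multiplicative.ofAdd.surjective δ
    have h1 := is_const_of_deriv_eq_zero hdiff hd (0 + γ) 0
    rw [hper] at h1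
    have n1 := Units.ne_zero (ρ (.ofAdd γ))
    have n3 := hne 0
    field_simp at h1
    exact h1

lemma HasParameter.isomorphic_iff {p p' : A₀ L} (h : E.HasParameter p)
    (h' : E'.HasParameter p') : E.Isomorphic E' ↔ p = p' := by
  rw [hasParameter_iff] at h h'
  constructor
  · rintro ⟨f, hf, hder⟩
    exact character_injective L ((exists_of_isIso h h' hf).2 hder).symm
  · rintro rfl
    obtain ⟨f, hf, hder⟩ := exists_isIso h h' 0 (by simp)
    exact ⟨f, hf, fun k i u hu ↦ by rw [hder k i u hu, sub_zero]⟩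

lemma HasParameter.lineBundle_isomorphic_iff {p p' : A₀ L} (h : E.HasParameter p)
    (h' : E'.HasParameter p') :
    E.toLineBundle.Isomorphic E'.toLineBundle ↔ p.proj = p'.proj := by
  rw [hasParameter_iff] at h h'
  obtain ⟨x, w, rfl⟩ := exists_point_eq p
  obtain ⟨x', w', rfl⟩ := exists_point_eq p'
  rw [character_point] at h h'
  -- Twisting by `exp(aγ)` moves only `w`, that is, it moves points along the fibres of `A₀ → C`.
  have hchi : ∀ a, ∀ γ : L.lattice, (chi L x (w + a) (.ofAdd γ) : ℂ) =
      chi L x w (.ofAdd γ) * exp (a * γ) := by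
    intro a γ
    rw [chi_apply, chi_apply, ← exp_add]
    ring_nf
  constructor
  · rintro ⟨f, hf⟩
    obtain ⟨a, ha⟩ := (exists_of_isIso h h' hf).1
    have : point L x (w + a) = point L x' w' := by
      refine point_eq_iff_chi.2 (MonoidHom.ext fun δ ↦ Units.ext ?_)
      obtain ⟨γ, rfl⟩ := Multiplicative.ofAdd.surjective δ
      rw [hchi, ha]
    have h2 := congrArg (fun p : A₀ L ↦ p.proj) this
    exact h2
  · intro hp
    obtain ⟨γ, rfl⟩ := exists_of_proj_eq (L := L) hp
    rw [← sub_add_cancel w' (quasiPeriod L γ), chi_add] at h'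
    obtain ⟨f, hf, -⟩ := exists_isIso h h' (w' - quasiPeriod L γ - w) fun δ ↦ by
      rw [← hchi]
      ring_nf
    exact ⟨f, hf⟩

end Connection

/-! ### The complex structures of `C` and `A₀` -/

lemma proj_chart {e : OpenPartialHomeomorph (Curve L) ℂ} (he : e ∈ atlas ℂ (Curve L))
    {b : Curve L} (hb : b ∈ e.source) : proj L (e b) = b := by
  obtain ⟨q, rfl⟩ := he
  exact (isLocalHomeomorph_proj L).apply_localInverseAt_of_mem hb.1

lemma symm_eq_proj {e : OpenPartialHomeomorph (Curve L) ℂ} (he : ∀ b ∈ e.source, proj L (e b) = b)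
    {z : ℂ} (hz : z ∈ e.target) : e.symm z = proj L z := by
  have := he _ (e.map_target hz)
  rw [e.right_inv hz] at this
  exact this.symm

/-- Read on `ℂ`, every local inverse of the projection is locally a translation, since it differs
from the identity by lattice vectors. -/
lemma eventually_localInverse_proj {e : Curve L → ℂ} {u : ℂ} (hc : ContinuousAt e (proj L u))
    (he : ∀ᶠ b in 𝓝 (proj L u), proj L (e b) = b) :
    ∀ᶠ w in 𝓝 u, e (proj L w) = w + (e (proj L u) - u) := by
  have hp := (continuous_proj L).continuousAt (x := u)
  have h := eventually_eq_of_mem_lattice (L := L) (f := fun w ↦ e (proj L w) - w) (u := u)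
    ((ContinuousAt.comp hc hp).sub continuousAt_id) ?_
  · filter_upwards [h] with w hw
    rw [← hw]
    ring
  · filter_upwards [hp.eventually he] with w hw
    exact sub_mem_lattice hw

lemma contDiffAt_localInverse_proj {e : Curve L → ℂ} {u : ℂ} (hc : ContinuousAt e (proj L u))
    (he : ∀ᶠ b in 𝓝 (proj L u), proj L (e b) = b) :
    ContDiffAt ℂ ω (fun w ↦ e (proj L w)) u := by
  refine ContDiffAt.congr_of_eventuallyEq ?_ (eventually_localInverse_proj hc he)
  exact contDiffAt_id.add contDiffAt_const

lemma contMDiff_proj : ContMDiff 𝓘(ℂ, ℂ) 𝓘(ℂ, ℂ) ω (proj L) := by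
  intro u
  rw [contMDiffAt_iff_target]
  refine ⟨(continuous_proj L).continuousAt, ?_⟩
  rw [contMDiffAt_iff_contDiffAt]
  have hs := mem_chart_source ℂ (proj L u)
  exact contDiffAt_localInverse_proj (e := chartAt ℂ (proj L u))
    ((chartAt ℂ (proj L u)).continuousAt hs)
    (((chartAt ℂ (proj L u)).open_source.eventually_mem hs).mono fun b hb ↦
      proj_chart (chart_mem_atlas ℂ _) hb)

lemma contMDiffAt_localInverse {e : Curve L → ℂ} {b : Curve L} (hc : ContinuousAt e b)
    (he : ∀ᶠ b in 𝓝 b, proj L (e b) = b) : ContMDiffAt 𝓘(ℂ, ℂ) 𝓘(ℂ, ℂ) ω e b := by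
  rw [contMDiffAt_iff]
  refine ⟨hc, ?_⟩
  set c := chartAt ℂ b with hcdef
  have hs : b ∈ c.source := mem_chart_source ℂ b
  have hsymm : ∀ z ∈ c.target, c.symm z = proj L z := fun z hz ↦
    symm_eq_proj (fun b hb ↦ proj_chart (chart_mem_atlas ℂ _) hb) hz
  have hb : proj L (c b) = b := proj_chart (chart_mem_atlas ℂ _) hs
  have h1 : ContDiffAt ℂ ω (fun w ↦ e (proj L w)) (c b) :=
    contDiffAt_localInverse_proj (by rwa [hb]) (by rwa [hb])
  refine (h1.congr_of_eventuallyEq ?_).contDiffWithinAt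
  filter_upwards [c.open_target.mem_nhds (c.map_source hs)] with z hz
  change e (c.symm z) = _
  rw [hsymm z hz]

lemma proj_lift₀_eventually {b : Curve L} (hb : b ∈ (lift₀ L).source) :
    ∀ᶠ b in 𝓝 b, proj L (lift₀ L b) = b :=
  ((lift₀ L).open_source.eventually_mem hb).mono fun _ hb ↦ proj_lift₀ L hb

lemma contDiffAt_chartShift (i : Bool) {u : ℂ} (hu : proj L u ∈ chartBase L i)
    (h0 : proj L u ≠ 0) : ContDiffAt ℂ ω (fun w ↦ chartShift L i (proj L w)) u := by
  cases i
  · exact contDiffAt_const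
  · have h1 := contDiffAt_localInverse_proj ((lift₀ L).continuousAt hu) (proj_lift₀_eventually hu)
    exact h1.inv (lift₀_ne_zero L hu h0)

/-- The shift `1 / u₀` is singular at `0`, but two different charts overlap only away from `0`, and
for equal charts the difference is zero. -/
lemma contDiffAt_chartShift_sub (i j : Bool) {u : ℂ} (hi : proj L u ∈ chartBase L i)
    (hj : proj L u ∈ chartBase L j) :
    ContDiffAt ℂ ω (fun w ↦ chartShift L j (proj L w) - chartShift L i (proj L w)) u := by
  by_cases h : i = j
  · subst h
    simpa using contDiffAt_const
  · have h0 : proj L u ≠ 0 := by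
      cases i
      · exact hi
      · cases j
        · exact hj
        · exact absurd rfl h
    exact (contDiffAt_chartShift j hj h0).sub (contDiffAt_chartShift i hi h0)

lemma exists_of_mem_atlas {e : OpenPartialHomeomorph (A₀ L) (ModelProd ℂ ℂ)}
    (he : e ∈ atlas (ModelProd ℂ ℂ) (A₀ L)) : ∃ (i : Bool) (c : OpenPartialHomeomorph (Curve L) ℂ),
      c ∈ atlas ℂ (Curve L) ∧ e = ((affineBundleCore L).localTriv i).toOpenPartialHomeomorph ≫ₕ
        c.prod (OpenPartialHomeomorph.refl ℂ) := by
  obtain ⟨_, ⟨_, ⟨i, rfl⟩, rfl⟩, _, ⟨c, hc, d, hd, rfl⟩, rfl⟩ := he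
  rw [chartedSpaceSelf_atlas] at hd
  subst hd
  exact ⟨i, c, hc, rfl⟩

lemma isManifold_A₀ (L : PeriodPair) : IsManifold (𝓘(ℂ, ℂ).prod 𝓘(ℂ, ℂ)) ω (A₀ L) := by
  refine isManifold_of_contDiffOn _ _ _ fun e e' he he' ↦ ?_
  obtain ⟨i, c, hc, rfl⟩ := exists_of_mem_atlas he
  obtain ⟨j, c', hc', rfl⟩ := exists_of_mem_atlas he'
  have hsymm : ∀ z ∈ c.target, c.symm z = proj L z := fun z hz ↦
    symm_eq_proj (fun b hb ↦ proj_chart hc hb) hz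
  have hcore : ∀ p ∈ ((((affineBundleCore L).localTriv i).toOpenPartialHomeomorph ≫ₕ
      c.prod (OpenPartialHomeomorph.refl ℂ)).symm ≫ₕ
      ((affineBundleCore L).localTriv j).toOpenPartialHomeomorph ≫ₕ
        c'.prod (OpenPartialHomeomorph.refl ℂ)).source,
      proj L p.1 ∈ chartBase L i ∧ proj L p.1 ∈ chartBase L j ∧ proj L p.1 ∈ c'.source ∧
      (((affineBundleCore L).localTriv i).toOpenPartialHomeomorph ≫ₕ
      c.prod (OpenPartialHomeomorph.refl ℂ)).symm.trans
      (((affineBundleCore L).localTriv j).toOpenPartialHomeomorph ≫ₕ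
        c'.prod (OpenPartialHomeomorph.refl ℂ)) p = (c' (proj L p.1),
          p.2 + (chartShift L j (proj L p.1) - chartShift L i (proj L p.1))) := by
    rintro ⟨z, v⟩ hzv
    simp only [mfld_simps] at hzv
    obtain ⟨⟨hz, hi⟩, hj, hs⟩ := hzv
    -- The change of charts passes through the fibre coordinate of `indexAt`, whose shift cancels.
    have e : ∀ b : Curve L, (c' b, (v + (chartShift L ((affineBundleCore L).indexAt b) b -
        chartShift L i b)) + (chartShift L j b - chartShift L ((affineBundleCore L).indexAt b) b)) =
        (c' b, v + (chartShift L j b - chartShift L i b)) := fun b ↦ by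
      congr 1
      ring
    have h := e (c.symm z)
    rw [hsymm z hz] at hi hj hs
    refine ⟨hi, hj, hs, Eq.trans h ?_⟩
    rw [hsymm z hz]
  intro p hp
  obtain ⟨h1, h2, h3, -⟩ := hcore p hp.1
  refine ContDiffWithinAt.congr (f := fun p : ℂ × ℂ ↦ (c' (proj L p.1),
    p.2 + (chartShift L j (proj L p.1) - chartShift L i (proj L p.1)))) ?_
    (fun q hq ↦ (hcore q hq.1).2.2.2) (hcore p hp.1).2.2.2
  have h4 := contDiffAt_localInverse_proj (c'.continuousAt h3)
    ((c'.open_source.eventually_mem h3).mono fun b hb ↦ proj_chart hc' hb)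
  refine ContDiffAt.contDiffWithinAt (.prodMk (h4.comp p contDiffAt_fst) (contDiffAt_snd.add ?_))
  exact (contDiffAt_chartShift_sub i j h1 h2).comp p contDiffAt_fst

/-! ### The Riemann–Hilbert mapping is biholomorphic -/

lemma zetaHat_analyticAt_of_notMem {x : ℂ} (hx : x ∉ L.lattice) : AnalyticAt ℂ (zetaHat L) x := by
  have h1 : DifferentiableOn ℂ (zeta L) (L.lattice : Set ℂ)ᶜ := fun w hw ↦
    (hasDerivAt_zeta L hw).differentiableAt.differentiableWithinAt
  refine (h1.analyticAt ((isOpen_compl_lattice L).mem_nhds hx)).congr ?_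
  filter_upwards [(isOpen_compl_lattice L).mem_nhds hx] with w hw
    using (zetaHat_of_notMem hw).symm

lemma deriv_sigmaQuot_zero (L : PeriodPair) : deriv (sigmaQuot L) 0 = 0 := by
  have h1 := deriv_comp_neg (sigmaQuot L) 0
  simp only [sigmaQuot_neg, neg_zero] at h1
  linear_combination h1 / 2

/-- The zeta function minus its polar part is analytic at `0`. -/
lemma analyticAt_zetaHat_sub_inv (L : PeriodPair) :
    AnalyticAt ℂ (fun x ↦ zetaHat L x - x⁻¹) 0 := by
  have h1 : AnalyticAt ℂ (logDeriv (sigmaQuot L)) 0 :=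
    (analyticAt_sigmaQuot L 0).deriv.div (analyticAt_sigmaQuot L 0) (by simp [sigmaQuot_zero])
  refine h1.congr ?_
  have h2 := eventually_nhdsWithin_iff.1 (eventually_notMem_lattice L 0)
  filter_upwards [h2] with x hx
  -- At `0` the conventions `zetaHat L 0 = 0` and `0⁻¹ = 0` agree with the analytic value, because
  -- `sigmaQuot` is even.
  by_cases h : x = 0
  · rw [h, logDeriv_apply, deriv_sigmaQuot_zero, zetaHat_zero]
    simp
  · rw [logDeriv_sigmaQuot (hx h), zetaHat_of_notMem (hx h), one_div]

lemma lift₀_zero (L : PeriodPair) : lift₀ L 0 = 0 := by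
  have h := (lift₀ L).right_inv (zero_mem_lift₀_target L)
  rwa [lift₀_symm, show proj L 0 = 0 from rfl] at h

/-- The fibre coordinate of `A₀` near the fibre of `x₀`, pulled back to the universal cover. -/
lemma exists_trivialization_point (L : PeriodPair) (x₀ : ℂ) : ∃ G : ℂ → ℂ, AnalyticAt ℂ G x₀ ∧
    ∀ᶠ x in 𝓝 x₀, ∀ w, (trivializationAt ℂ (affineBundleCore L).Fiber (proj L x₀)
      (point L x w)).2 = w - G x := by
  by_cases hx₀ : x₀ ∈ L.lattice
  · have h0 : proj L x₀ = 0 := (proj_eq_zero_iff L x₀).2 hx₀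
    -- Near the fibre over `0`, the shift `1 / u₀` of the chart cancels the polar part of `ζ`.
    refine ⟨fun x ↦ zetaHat L x - (x - x₀)⁻¹, ?_, ?_⟩
    · have h1 : AnalyticAt ℂ (fun x ↦ (zetaHat L (x - x₀) - (x - x₀)⁻¹) +
          quasiPeriod L ⟨x₀, hx₀⟩) x₀ := by
        refine AnalyticAt.add ?_ analyticAt_const
        have h2 : AnalyticAt ℂ (fun x ↦ zetaHat L x - x⁻¹) (x₀ - x₀) := by
          rw [sub_self]
          exact analyticAt_zetaHat_sub_inv L
        exact AnalyticAt.comp (f := fun x ↦ x - x₀) h2 (analyticAt_id.sub analyticAt_const)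
      refine h1.congr (.of_forall fun x ↦ ?_)
      have := zetaHat_add L (x - x₀) ⟨x₀, hx₀⟩
      simp only [sub_add_cancel] at this
      simp only [this]
      ring
    · have hl := eventually_localInverse_proj (e := lift₀ L) (u := x₀)
        ((lift₀ L).continuousAt (by rw [h0]; exact zero_mem_lift₀_source L))
        (proj_lift₀_eventually (by rw [h0]; exact zero_mem_lift₀_source L))
      filter_upwards [hl] with x hx w
      rw [h0, lift₀_zero] at hx
      have hinv : lift₀ L (proj L x) = x - x₀ := by rw [hx]; ring
      change (w - zetaHat L x) + (chartShift L ((affineBundleCore L).indexAt (proj L x₀)) (proj L x)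
        - chartShift L ((affineBundleCore L).indexAt (proj L x)) (proj L x)) = _
      by_cases hx0 : proj L x = 0
      · have : x - x₀ = 0 := by rw [← hinv, hx0, lift₀_zero]
        rw [hx0, h0, this]
        simp
      · have e1 : (affineBundleCore L).indexAt (proj L x₀) = true := if_pos h0
        have e2 : (affineBundleCore L).indexAt (proj L x) = false := if_neg hx0
        rw [e1, e2]
        simp only [chartShift, hinv]
        ring
  · refine ⟨zetaHat L, zetaHat_analyticAt_of_notMem hx₀, ?_⟩
    filter_upwards [(isOpen_compl_lattice L).mem_nhds hx₀] with x hx w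
    have e : ∀ y, y ∉ L.lattice → (affineBundleCore L).indexAt (proj L y) = false := fun y hy ↦
      if_neg fun h ↦ hy ((proj_eq_zero_iff L y).1 h)
    change (w - zetaHat L x) + (chartShift L ((affineBundleCore L).indexAt (proj L x₀)) (proj L x)
      - chartShift L ((affineBundleCore L).indexAt (proj L x)) (proj L x)) = _
    rw [e x₀ hx₀, e x hx]
    simp

lemma contMDiff_point (L : PeriodPair) :
    ContMDiff 𝓘(ℂ, ℂ × ℂ) (𝓘(ℂ, ℂ).prod 𝓘(ℂ, ℂ)) ω (fun q : ℂ × ℂ ↦ point L q.1 q.2) := by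
  rintro ⟨x₀, w₀⟩
  obtain ⟨G, hG, hev⟩ := exists_trivialization_point L x₀
  rw [Bundle.contMDiffAt_totalSpace]
  constructor
  · exact (contMDiff_proj (L := L)).contMDiffAt.comp (x₀, w₀) contDiff_fst.contMDiff.contMDiffAt
  · have h1 : ContDiffAt ℂ ω (fun q : ℂ × ℂ ↦ q.2 - G q.1) (x₀, w₀) :=
      contDiffAt_snd.sub (hG.contDiffAt.comp (x₀, w₀) contDiffAt_fst)
    refine h1.contMDiffAt.congr_of_eventuallyEq ?_
    filter_upwards [continuousAt_fst.eventually hev] with q hq using hq q.2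

lemma rhMap_point (L : PeriodPair) (x w : ℂ) :
    ((rhMap L (point L x w)).1 : ℂ) = exp (w * L.ω₁ - x * quasiPeriod L (gen₁ L)) ∧
    ((rhMap L (point L x w)).2 : ℂ) = exp (w * L.ω₂ - x * quasiPeriod L (gen₂ L)) := by
  rw [rhMap, character_point]
  exact ⟨chi_apply L x w (gen₁ L), chi_apply L x w (gen₂ L)⟩

/-- Local holomorphic sections of `ℂ² → A₀`. -/
lemma exists_section_point (p : A₀ L) : ∃ X W : A₀ L → ℂ,
    ContMDiffAt (𝓘(ℂ, ℂ).prod 𝓘(ℂ, ℂ)) 𝓘(ℂ, ℂ) ω X p ∧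
    ContMDiffAt (𝓘(ℂ, ℂ).prod 𝓘(ℂ, ℂ)) 𝓘(ℂ, ℂ) ω W p ∧ ∀ᶠ q in 𝓝 p, point L (X q) (W q) = q := by
  obtain ⟨x₀, hx₀⟩ := proj_surjective L p.proj
  obtain ⟨G, hG, hev⟩ := exists_trivialization_point L x₀
  obtain ⟨e, hxe, he⟩ := isLocalHomeomorph_proj L x₀
  have hb : p.proj ∈ e.target := by
    rw [← hx₀, he]
    exact e.map_source hxe
  have hex : e.symm p.proj = x₀ := by
    rw [← hx₀, he]
    exact e.left_inv hxe
  have hec : ContinuousAt e.symm p.proj := e.symm.continuousAt hb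
  have hep : ∀ᶠ b in 𝓝 p.proj, proj L (e.symm b) = b := by
    filter_upwards [e.open_target.mem_nhds hb] with b hb
    rw [he]
    exact e.right_inv hb
  have hid := (Bundle.contMDiffAt_totalSpace (IM := 𝓘(ℂ, ℂ).prod 𝓘(ℂ, ℂ)) (IB := 𝓘(ℂ, ℂ))
    (F := ℂ) (E := (affineBundleCore L).Fiber) (n := ω) (f := id) (x₀ := p)).1 contMDiffAt_id
  have hX : ContMDiffAt (𝓘(ℂ, ℂ).prod 𝓘(ℂ, ℂ)) 𝓘(ℂ, ℂ) ω (fun q : A₀ L ↦ e.symm q.proj) p :=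
    (contMDiffAt_localInverse hec hep).comp p hid.1
  have hGX : ContMDiffAt (𝓘(ℂ, ℂ).prod 𝓘(ℂ, ℂ)) 𝓘(ℂ, ℂ) ω (fun q : A₀ L ↦ G (e.symm q.proj)) p :=
    ContMDiffAt.comp p (g := G) (by rw [hex]; exact hG.contDiffAt.contMDiffAt) hX
  refine ⟨_, fun q ↦ (trivializationAt ℂ (affineBundleCore L).Fiber p.proj q).2 +
    G (e.symm q.proj), hX, hid.2.add hGX, ?_⟩
  have hcont : ContinuousAt (fun q : A₀ L ↦ e.symm q.proj) p := hX.continuousAt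
  have hproj : ContinuousAt (fun q : A₀ L ↦ q.proj) p := hid.1.continuousAt
  rw [ContinuousAt, hex] at hcont
  filter_upwards [hcont.eventually hev, hproj.eventually hep,
    hproj.eventually ((trivializationAt ℂ (affineBundleCore L).Fiber p.proj).open_baseSet.mem_nhds
      (FiberBundle.mem_baseSet_trivializationAt ℂ (affineBundleCore L).Fiber p.proj))]
    with q h1 h2 h3
  obtain ⟨w, hw⟩ : ∃ w, point L (e.symm q.proj) w = q := by
    obtain ⟨b, v⟩ := q
    exact ⟨(show ℂ from v) + zetaHat L (e.symm b), A₀_ext h2 (add_sub_cancel_right _ _)⟩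
  have h4 := h1 w
  rw [hw, hx₀] at h4
  rw [h4, sub_add_cancel, hw]

/-- On local lifts to `ℂ²` both components are exponentials of linear forms. -/
lemma contMDiff_rhMap (L : PeriodPair) :
    ContMDiff (𝓘(ℂ, ℂ).prod 𝓘(ℂ, ℂ)) (𝓘(ℂ, ℂ).prod 𝓘(ℂ, ℂ)) ω (rhMap L) := by
  have key : ∀ a b : ℂ, ∀ f : A₀ L → ℂˣ,
      (∀ x w, (f (point L x w) : ℂ) = exp (w * a - x * b)) →
      ContMDiff (𝓘(ℂ, ℂ).prod 𝓘(ℂ, ℂ)) 𝓘(ℂ, ℂ) ω f := by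
    intro a b f hf
    refine ContMDiff.of_comp_isOpenEmbedding Units.isOpenEmbedding_val fun p ↦ ?_
    obtain ⟨X, W, hX, hW, hev⟩ := exists_section_point p
    have h1 : ContDiff ℂ ω (fun q : ℂ × ℂ ↦ exp (q.2 * a - q.1 * b)) := by fun_prop
    have h2 := (h1.contMDiff.contMDiffAt (x := (X p, W p))).comp p (hX.prodMk_space hW)
    refine h2.congr_of_eventuallyEq ?_
    filter_upwards [hev] with q hq
    simp only [Function.comp_apply]
    rw [← hf, hq]
  exact (key _ _ _ fun x w ↦ (rhMap_point L x w).1).prodMk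
    (key _ _ _ fun x w ↦ (rhMap_point L x w).2)

/-- The Riemann–Hilbert mapping as a bijection. -/
def rhEquiv (L : PeriodPair) : A₀ L ≃ ℂˣ × ℂˣ :=
  Equiv.ofBijective (rhMap L) ⟨rhMap_injective L, rhMap_surjective L⟩

lemma contMDiff_rhEquiv_symm (L : PeriodPair) :
    ContMDiff (𝓘(ℂ, ℂ).prod 𝓘(ℂ, ℂ)) (𝓘(ℂ, ℂ).prod 𝓘(ℂ, ℂ)) ω (rhEquiv L).symm := by
  rintro ⟨A₀, B₀⟩
  -- A branch of the logarithm centred at `A₀`: near `A = A₀` the quotient is close to `1`, away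
  -- from the cut. `periodSolve` then inverts the linear part.
  let lg : ℂˣ → ℂˣ → ℂ := fun A₀ A ↦ log (A / A₀) + log A₀
  have hlg : ∀ A₀ A, exp (lg A₀ A) = A := by
    intro A₀ A
    rw [exp_add, exp_log (div_ne_zero A.ne_zero A₀.ne_zero), exp_log A₀.ne_zero,
      div_mul_cancel₀ _ A₀.ne_zero]
  have hsm : ∀ A₀, ContMDiffAt 𝓘(ℂ, ℂ) 𝓘(ℂ, ℂ) ω (lg A₀) A₀ := by
    intro A₀
    have h1 : ContDiffAt ℂ ω (fun z : ℂ ↦ log (z / A₀) + log A₀) A₀ := by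
      refine ContDiffAt.add (ContDiffAt.comp (A₀ : ℂ) (Complex.contDiffAt_log ?_)
        (contDiffAt_id.div_const _)) contDiffAt_const
      rw [div_self A₀.ne_zero]
      exact one_mem_slitPlane
    exact h1.contMDiffAt.comp A₀ Units.contMDiff_val.contMDiffAt
  have hsolve : ContDiff ℂ ω (fun q : ℂ × ℂ ↦ periodSolve L q.1 q.2) := by
    unfold periodSolve
    fun_prop
  have h1 := (((contMDiff_point L).comp hsolve.contMDiff).contMDiffAt
    (x := (lg A₀ A₀, lg B₀ B₀))).comp (A₀, B₀)
    (((hsm A₀).comp (A₀, B₀) contMDiffAt_fst).prodMk_space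
      ((hsm B₀).comp (A₀, B₀) contMDiffAt_snd))
  refine h1.congr_of_eventuallyEq (.of_forall ?_)
  rintro ⟨A, B⟩
  rw [Equiv.symm_apply_eq]
  exact (rhMap_point_periodSolve L _ _ A B (hlg A₀ A) (hlg B₀ B)).symm

/-- The Riemann–Hilbert mapping as a biholomorphism. -/
def rhDiffeomorph (L : PeriodPair) : Diffeomorph (𝓘(ℂ, ℂ).prod 𝓘(ℂ, ℂ))
    (𝓘(ℂ, ℂ).prod 𝓘(ℂ, ℂ)) (A₀ L) (ℂˣ × ℂˣ) ω where
  toEquiv := rhEquiv L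
  contMDiff_toFun := contMDiff_rhMap L
  contMDiff_invFun := contMDiff_rhEquiv_symm L

/-- `A₀ → C` has no holomorphic section. -/
lemma not_exists_section (L : PeriodPair) :
    ¬ ∃ s : Curve L → A₀ L, ContMDiff 𝓘(ℂ, ℂ) (𝓘(ℂ, ℂ).prod 𝓘(ℂ, ℂ)) ω s ∧
      ∀ b, (s b).proj = b := by
  rintro ⟨s, hs, hproj⟩
  -- Pulled back to `ℂ`, the composite of the section with `rhMap` has entire periodic components,
  -- hence constant ones, whereas the section separates the points `ω₁ / 2` and `0` of `C`.
  have h := (contMDiff_rhMap L).comp (hs.comp contMDiff_proj)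
  have key : ∀ f : ℂ → ℂˣ, ContMDiff 𝓘(ℂ, ℂ) 𝓘(ℂ, ℂ) ω f →
      (∀ z, ∀ γ : L.lattice, f (z + γ) = f z) → ∀ z w, f z = f w := by
    intro f hf hper z w
    have h1 : Differentiable ℂ (fun z ↦ (f z : ℂ)) :=
      (Units.contMDiff_val.comp hf).contDiff.differentiable (by simp)
    exact Units.ext (eq_const_of_norm_periodic h1 (fun z γ ↦ by rw [hper]) z w)
  have hconst : ∀ z w, rhMap L (s (proj L z)) = rhMap L (s (proj L w)) := fun z w ↦
    Prod.ext (key _ (contMDiff_fst.comp h) (fun z γ ↦ by simp [proj_add]) z w)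
      (key _ (contMDiff_snd.comp h) (fun z γ ↦ by simp [proj_add]) z w)
  have h1 := congrArg (fun p : A₀ L ↦ p.proj) (rhMap_injective L (hconst (L.ω₁ / 2) 0))
  simp only [hproj] at h1
  exact L.ω₁_div_two_notMem_lattice ((proj_eq_zero_iff L _).1 h1)

end EllipticRH

end

open EllipticRH in
theorem mainTheorem2 (τ : UpperHalfPlane) (L : PeriodPair) (hL : L = periods τ) :
    -- `A₀` is a complex surface
    IsManifold (𝓘(ℂ, ℂ).prod 𝓘(ℂ, ℂ)) ω (A₀ L) ∧
    -- `A₀ → C` has no holomorphic section (the ruled surface compactifying it is undecomposable)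
    (¬ ∃ s : Curve L → A₀ L, ContMDiff 𝓘(ℂ, ℂ) (𝓘(ℂ, ℂ).prod 𝓘(ℂ, ℂ)) ω s ∧
      ∀ b, (s b).proj = b) ∧
    -- `ζ` is a primitive of `-℘`, with quasi-periods `quasiPeriod`
    (∀ u ∉ L.lattice, HasDerivAt (zeta L) (-℘[L] u) u ∧
      ∀ γ : L.lattice, zeta L (u + γ) = zeta L u + quasiPeriod L γ) ∧
    -- isomorphism classes of connections are in bijection with the points of `A₀`,
    -- and classes of underlying line bundles with the points of `C`
    (∀ p : A₀ L, ∃ E : Connection L, E.HasParameter p) ∧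
    (∀ E : Connection L, ∃! p : A₀ L, E.HasParameter p) ∧
    (∀ (E E' : Connection L) (p p' : A₀ L), E.HasParameter p → E'.HasParameter p' →
      (E.Isomorphic E' ↔ p = p') ∧
      (E.toLineBundle.Isomorphic E'.toLineBundle ↔ p.proj = p'.proj)) ∧
    -- integration by the sigma function
    (∀ u₀ c : ℂ, u₀ ∉ L.lattice → ∀ u ∉ L.lattice,
      (℘[L] u ≠ ℘[L] u₀ →
        HasDerivAt (solution L u₀ c) (mainForm L u₀ c u * solution L u₀ c u) u) ∧
      ∀ γ : L.lattice, solution L u₀ c (u + γ) =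
        exp (-u₀ * quasiPeriod L γ + zeta L u₀ * γ + c * γ) * solution L u₀ c u) ∧
    -- the Riemann-Hilbert mapping
    ∃ M : Diffeomorph (𝓘(ℂ, ℂ).prod 𝓘(ℂ, ℂ)) (𝓘(ℂ, ℂ).prod 𝓘(ℂ, ℂ)) (A₀ L) (ℂˣ × ℂˣ) ω,
      (∀ (E : Connection L) (p : A₀ L) (ρ : Multiplicative L.lattice →* ℂˣ), E.HasParameter p →
        (E.HasMonodromy ρ ↔
          M p = (ρ (Multiplicative.ofAdd (gen₁ L)), ρ (Multiplicative.ofAdd (gen₂ L))))) ∧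
      (∀ u₀ c : ℂ, u₀ ∉ L.lattice →
        ((M (mainPoint L u₀ c)).1 : ℂ) = exp (-u₀ * quasiPeriod L (gen₁ L) + zeta L u₀ + c) ∧
        ((M (mainPoint L u₀ c)).2 : ℂ) =
          exp (-u₀ * quasiPeriod L (gen₂ L) + zeta L u₀ * τ + c * τ)) ∧
      (∀ c₀ : ℂ, ((M (zeroPoint L c₀)).1 : ℂ) = exp c₀ ∧
        ((M (zeroPoint L c₀)).2 : ℂ) = exp (c₀ * τ)) ∧
      (∀ (E E' : Connection L) (p p' q : A₀ L), E.HasParameter p → E'.HasParameter p' →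
        (E.tensor E').HasParameter q → M q = M p * M p') := by
  subst hL
  refine ⟨isManifold_A₀ _, not_exists_section _,
    fun u hu ↦ ⟨hasDerivAt_zeta _ hu, zeta_add _ hu⟩, exists_hasParameter,
    Connection.existsUnique_hasParameter,
    fun E E' p p' h h' ↦ ⟨h.isomorphic_iff h', h.lineBundle_isomorphic_iff h'⟩,
    fun u₀ c h0 u hu ↦ ⟨hasDerivAt_solution c hu h0, solution_add _ u₀ c u⟩,
    rhDiffeomorph _, fun E p ρ h ↦ h.hasMonodromy_iff, fun u₀ c h0 ↦ ?_, fun c₀ ↦ ?_,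
    fun E E' p p' q h h' hq ↦ Connection.rhMap_tensor h h' hq⟩
  · change ((rhMap _ _).1 : ℂ) = _ ∧ ((rhMap _ _).2 : ℂ) = _
    rw [mainPoint_eq h0, (rhMap_point _ _ _).1, (rhMap_point _ _ _).2]
    constructor <;> congr 1 <;> simp only [periods] <;> ring
  · change ((rhMap _ _).1 : ℂ) = _ ∧ ((rhMap _ _).2 : ℂ) = _
    rw [zeroPoint_eq, (rhMap_point _ _ _).1, (rhMap_point _ _ _).2]
    constructor <;> congr 1 <;> simp only [periods] <;> ring
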